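/- **Setting.** For every sample size $n$ the data have law $P_0^{(n)}$; probability statements, $o_p(1)$ and weak convergence $\Rightarrow$ refer to $P_0^{(n)}$ as $n\to\infty$. Let $\Theta\subseteq\mathbb R^d$ be a measurable parameter set (not necessarily compact), $q_n(\theta)$ a data-dependent loss (for instance $q_n(\theta)=\sum_{i=1}^n q(y_i,\theta)$), and $\psi_n(\theta)$ estimating functions with $\psi_n(\theta)=\nabla_\theta q_n(\theta)$ almost surely, for each $\theta\in\Theta$. Let $V_n(\theta)$ be a data-dependent $d\times d$ matrix (an estimator of $\mathrm{Cov}\{\psi_n(\theta)/\sqrt n\}$) and $\pi$ a prior probability density on $\Theta$; $\psi_n$ and $V_n$ are jointly measurable in the data and $\theta$. The generalized Q-posterior is $$\pi_n^\Psi(\theta)=\frac{e^{-\Psi_n(\theta)}\pi(\theta)}{\int_\Theta e^{-\Psi_n(\theta')}\pi(\theta')\,d\theta'},\qquad \Psi_n(\theta)=\frac12\,\frac{\psi_n(\theta)^\top}{\sqrt n}V_n(\theta)^{-1}\frac{\psi_n(\theta)}{\sqrt n}.$$ **Assumptions.** There are non-random functions $\psi:\Theta\to\mathbb R^d$, $V:\Theta\to\mathbb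 R^{d\times d}$, a point $\theta_\star\in\mathrm{Int}(\Theta)$ and a positive semi-definite matrix $V_\star$ such that the following hold. (A) *Estimating functions.* 1. $\sup_{\theta\in\Theta}\|n^{-1}\psi_n(\theta)-\psi(\theta)\|=o_p(1)$. 2. For $\theta\in\Theta$: $\psi(\theta)=0$ if and only if $\theta=\theta_\star$. 3. $\psi$ is continuously differentiable on some ball $\|\theta-\theta_\star\|\le\delta$, and $\nabla_\theta\psi(\theta_\star)$ is invertible. 4. $\psi_n(\theta_\star)/\sqrt n\Rightarrow N(0,V_\star)$. 5. For every $\epsilon>0$ there is $\delta>0$ such that $$P_0^{(n)}\left(\sup_{\theta,\theta'\in\Theta,\ \|\theta-\theta'\|<\delta}\frac{\sqrt n\,\bigl\|n^{-1}\{\psi_n(\theta)-\psi_n(\theta')\}-\{\psi(\theta)-\psi(\theta')\}\bigr\|}{1+\sqrt n\|\theta-\theta'\|}>\epsilon\right)\to0 .$$ (B) *Variance estimator.* For some $\delta>0$: 1. for all $n$ large enough, almost surely, $V_n(\theta)$ is symmetric positive semi-definite for all $\theta\in\Theta$, and positive definite if $\|\theta-\theta_\star\|\le\delta$; 2. $V(\theta)$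 is symmetric positive semi-definite for all $\theta\in\Theta$, and continuous and positive definite on $\{\theta\in\Theta:\|\theta-\theta_\star\|\le\delta\}$; moreover $\sup_{\theta\in\Theta}\|V_n(\theta)-V(\theta)\|=o_p(1)$; 3. $V(\theta_\star)=V_\star$; 4. for every $\epsilon>0$ there is $\kappa>0$ with $\sup_{\theta\in\Theta,\ \|\theta-\theta_\star\|\ge\epsilon}-\psi(\theta)^\top\{V(\theta)+\kappa I\}^{-1}\psi(\theta)<0$. (C) *Prior.* $\pi$ is continuous on $\Theta$, $\pi(\theta_\star)>0$, and for some $p\ge1$: $\int_\Theta\|\theta\|^p\pi(\theta)\,d\theta<\infty$ and, for all $n$ large enough, almost surely, $\int_\Theta|V_n(\theta)|^{-1/2}\|\theta-\theta_\star\|^p\pi(\theta)\,d\theta<\infty$, where $|V_n(\theta)|^{-1/2}=+\infty$ if $V_n(\theta)$ is singular. **Conclusion.** Put $\Omega_\star=\nabla_\theta\psi(\theta_\star)^\top V(\theta_\star)^{-1}\nabla_\theta\psi(\theta_\star)$, $Z_n=-\Omega_\star^{-1}\nabla_\theta\psi(\theta_\star)^\top V(\theta_\star)^{-1}\psi_n(\theta_\star)$,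 $\vartheta=\sqrt n(\theta-\theta_\star)-Z_n/\sqrt n$ and $\mathcal T_n=\{\sqrt n(\theta-\theta_\star)-Z_n/\sqrt n:\theta\in\Theta\}$; let $\pi^\Psi_n(\vartheta)$ be the posterior density of $\vartheta$ on $\mathcal T_n$ and $N\{\cdot\,;0,\Omega_\star^{-1}\}$ the density of $N(0,\Omega_\star^{-1})$. Then, for all $n$ large enough, almost surely the posterior is a proper density with finite mean $\overline\theta=\int_\Theta\theta\,\pi_n^\Psi(\theta)\,d\theta$; as $n\to\infty$, $$\int_{\mathcal T_n}\|\vartheta\|\,\bigl|\pi_n^\Psi(\vartheta)-N\{\vartheta;0,\Omega_\star^{-1}\}\bigr|\,d\vartheta=o_p(1),$$ and $$\sqrt n(\overline\theta-\theta_\star)\Rightarrow N(0,\Omega_\star^{-1}).$$ -/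

import Mathlib

open MeasureTheory ProbabilityTheory Filter Topology
open scoped ENNReal Matrix Matrix.Norms.L2Operator

noncomputable section

namespace QPosterior

/-- The Euclidean space `ℝᵈ`. -/
abbrev E (d : ℕ) : Type := EuclideanSpace ℝ (Fin d)

/-- The quadratic form `xᵀ A x`. -/
def quadForm {d : ℕ} (A : Matrix (Fin d) (Fin d) ℝ) (x : E d) : ℝ :=
  x.ofLp ⬝ᵥ (A *ᵥ x.ofLp)

/-- The Jacobian matrix `∇ψ(θ) = (∂ψᵢ/∂θⱼ)ᵢⱼ`. -/
def jacobian {d : ℕ} (ψ : E d → E d) (θ : E d) : Matrix (Fin d) (Fin d) ℝ :=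
  Matrix.of fun i j => (fderiv ℝ ψ θ (EuclideanSpace.single j 1)) i

/-- The density at `x` of the centred Gaussian law with (positive definite) covariance `S`. -/
def gaussianDensity {d : ℕ} (S : Matrix (Fin d) (Fin d) ℝ) (x : E d) : ℝ :=
  (Real.sqrt ((2 * Real.pi) ^ d * S.det))⁻¹ * Real.exp (-(1 / 2) * quadForm S⁻¹ x)

section Posterior

/-! Here `n` is the sample size, `ψn` the estimating function and `Vn` the variance estimator,
both at the observed data; `π` is the prior density on `Θ`. -/

variable {d : ℕ} (Θ : Set (E d)) (n : ℕ) (ψn : E d → E d)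
  (Vn : E d → Matrix (Fin d) (Fin d) ℝ) (π : E d → ℝ)

/-- `Ψₙ(θ) = ½ (ψₙ(θ)/√n)ᵀ Vₙ(θ)⁻¹ (ψₙ(θ)/√n)`. -/
def criterion (θ : E d) : ℝ :=
  1 / 2 * quadForm (Vn θ)⁻¹ ((Real.sqrt n)⁻¹ • ψn θ)

/-- The unnormalised posterior `exp(-Ψₙ(θ)) π(θ)`. -/
def kernel (θ : E d) : ℝ := Real.exp (-criterion n ψn Vn θ) * π θ

/-- The Q-posterior density on `Θ`. -/
def posterior (θ : E d) : ℝ :=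
  kernel n ψn Vn π θ / ∫ θ' in Θ, kernel n ψn Vn π θ'

/-- The posterior mean `∫_Θ θ πₙ(θ) dθ`. -/
def posteriorMean : E d := ∫ θ in Θ, posterior Θ n ψn Vn π θ • θ

/-- The posterior density of the local parameter `ϑ = √n (θ - θ⋆) - Z/√n`, obtained from
the density of `θ` by the change of variables `θ = θ⋆ + Z/n + ϑ/√n`. -/
def localPosterior (θstar Z : E d) (ϑ : E d) : ℝ :=
  (Real.sqrt n ^ d)⁻¹ *
    posterior Θ n ψn Vn π (θstar + (n : ℝ)⁻¹ • Z + (Real.sqrt n)⁻¹ • ϑ)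

/-- The local parameter space `{√n (θ - θ⋆) - Z/√n : θ ∈ Θ}`. -/
def localSpace (θstar Z : E d) : Set (E d) :=
  (fun θ => Real.sqrt n • (θ - θstar) - (Real.sqrt n)⁻¹ • Z) '' Θ

end Posterior

/-- The matrix `Ω⋆ = ∇ψ(θ⋆)ᵀ V(θ⋆)⁻¹ ∇ψ(θ⋆)`. -/
def OmegaStar {d : ℕ} (ψ : E d → E d) (V : E d → Matrix (Fin d) (Fin d) ℝ) (θstar : E d) :
    Matrix (Fin d) (Fin d) ℝ :=
  (jacobian ψ θstar)ᵀ * (V θstar)⁻¹ * jacobian ψ θstar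

/-- The recentring vector `Zₙ = -Ω⋆⁻¹ ∇ψ(θ⋆)ᵀ V(θ⋆)⁻¹ ψₙ(θ⋆)`; the argument `s` is `ψₙ(θ⋆)`. -/
def recentring {d : ℕ} (ψ : E d → E d) (V : E d → Matrix (Fin d) (Fin d) ℝ) (θstar : E d)
    (s : E d) : E d :=
  -WithLp.toLp 2
    (((OmegaStar ψ V θstar)⁻¹ * (jacobian ψ θstar)ᵀ * (V θstar)⁻¹) *ᵥ s.ofLp)

section Assumptions

variable {d : ℕ} {Ω : ℕ → Type*} [∀ n, MeasurableSpace (Ω n)]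
  (P : ∀ n, Measure (Ω n)) [∀ n, IsProbabilityMeasure (P n)] (Θ : Set (E d))

/-- Conditions on the estimating functions `ψₙ` and their limit `ψ`. A statement that a supremum
over parameters exceeds `ε` is written as the existence of parameters at which `ε` is exceeded. -/
structure EstimatingAssumption (ψn : ∀ n, Ω n → E d → E d) (ψ : E d → E d)
    (θstar : E d) (Vstar : Matrix (Fin d) (Fin d) ℝ) : Prop where
  /-- `sup_Θ ‖ψₙ/n - ψ‖ = o_p(1)` -/
  uniform : ∀ ε : ℝ, 0 < ε → Tendsto
    (fun n => P n {ω | ∃ θ ∈ Θ, ε < ‖(n : ℝ)⁻¹ • ψn n ω θ - ψ θ‖}) atTop (𝓝 0)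
  interior : θstar ∈ interior Θ
  zero_iff : ∀ θ ∈ Θ, ψ θ = 0 ↔ θ = θstar
  contDiff : ∃ δ : ℝ, 0 < δ ∧ Metric.closedBall θstar δ ⊆ Θ ∧
    ContDiffOn ℝ 1 ψ (Metric.closedBall θstar δ)
  invertible : IsUnit (jacobian ψ θstar)
  posSemidef : Vstar.PosSemidef
  /-- `ψₙ(θ⋆)/√n ⇒ N(0, V⋆)` -/
  clt : TendstoInDistribution (fun (n : ℕ) ω => (Real.sqrt n)⁻¹ • ψn n ω θstar) atTop
    (id : E d → E d) P (multivariateGaussian 0 Vstar)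
  /-- stochastic equicontinuity -/
  equicontinuous : ∀ ε : ℝ, 0 < ε → ∃ δ : ℝ, 0 < δ ∧ Tendsto
    (fun n => P n {ω | ∃ θ ∈ Θ, ∃ θ' ∈ Θ, ‖θ - θ'‖ < δ ∧
      ε < Real.sqrt n * ‖(n : ℝ)⁻¹ • (ψn n ω θ - ψn n ω θ') - (ψ θ - ψ θ')‖ /
        (1 + Real.sqrt n * ‖θ - θ'‖)}) atTop (𝓝 0)

/-- Conditions on the variance estimator `Vₙ` and its limit `V`. The matrices may be singular away
from `θ⋆`, and the separation of `θ⋆` is expressed through `V + κ I`, which is always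
invertible for `κ > 0`. -/
structure WeightAssumption (Vn : ∀ n, Ω n → E d → Matrix (Fin d) (Fin d) ℝ)
    (V : E d → Matrix (Fin d) (Fin d) ℝ) (ψ : E d → E d)
    (θstar : E d) (Vstar : Matrix (Fin d) (Fin d) ℝ) : Prop where
  local_global : ∃ δ : ℝ, 0 < δ ∧
    (∀ᶠ n in atTop, ∀ᵐ ω ∂P n, (∀ θ ∈ Θ, (Vn n ω θ).PosSemidef) ∧
      ∀ θ ∈ Θ, ‖θ - θstar‖ ≤ δ → (Vn n ω θ).PosDef) ∧
    (∀ θ ∈ Θ, (V θ).PosSemidef) ∧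
    ContinuousOn V (Θ ∩ Metric.closedBall θstar δ) ∧
    ∀ θ ∈ Θ, ‖θ - θstar‖ ≤ δ → (V θ).PosDef
  /-- `sup_Θ ‖Vₙ - V‖ = o_p(1)` -/
  uniform : ∀ ε : ℝ, 0 < ε → Tendsto
    (fun n => P n {ω | ∃ θ ∈ Θ, ε < ‖Vn n ω θ - V θ‖}) atTop (𝓝 0)
  at_star : V θstar = Vstar
  separated : ∀ ε : ℝ, 0 < ε → ∃ κ : ℝ, 0 < κ ∧ ∃ c : ℝ, 0 < c ∧
    ∀ θ ∈ Θ, ε ≤ ‖θ - θstar‖ → c ≤ quadForm (V θ + κ • 1)⁻¹ (ψ θ)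

/-- Conditions on the prior density `π`. In the last one a zero determinant contributes
`0 ^ (-1/2) = ∞`. -/
structure PriorAssumption (Vn : ∀ n, Ω n → E d → Matrix (Fin d) (Fin d) ℝ)
    (π : E d → ℝ) (θstar : E d) : Prop where
  nonneg : ∀ θ ∈ Θ, 0 ≤ π θ
  normalised : ∫⁻ θ in Θ, ENNReal.ofReal (π θ) = 1
  pos_star : 0 < π θstar
  continuousOn : ContinuousOn π Θ
  moments : ∃ p : ℝ, 1 ≤ p ∧
    ∫⁻ θ in Θ, ENNReal.ofReal (‖θ‖ ^ p * π θ) < ∞ ∧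
    ∀ᶠ n in atTop, ∀ᵐ ω ∂P n,
      ∫⁻ θ in Θ, ENNReal.ofReal (Vn n ω θ).det ^ (-(1 / 2) : ℝ) *
        ENNReal.ofReal (‖θ - θstar‖ ^ p * π θ) < ∞

end Assumptions

end QPosterior

end

/-!
The proof separates analysis from probability.

**Analysis.** Fix a sequence of data points along which all the stochastic bounds hold as
deterministic limits (`TypicalSeq`). With `Zₙ = -∇ψ(θ⋆)⁻¹ψₙ(θ⋆)` (`recentring_eq`), stochastic
equicontinuity and differentiability of `ψ` at `θ⋆` give `ψₙ(θ)/√n = ∇ψ(θ⋆)ϑ` up to a small multiple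
of `1 + √n‖θ - θ⋆‖`, on a fixed neighbourhood of `θ⋆` (`TypicalSeq.linearisation`). Hence the
posterior kernel, in the local coordinate `ϑ`, converges pointwise to `π(θ⋆) exp(-½ ϑᵀΩ⋆ϑ)` and is
dominated near `θ⋆` by a Gaussian function (`TypicalSeq.tendsto_localKernel`,
`TypicalSeq.exists_gaussian_bound`), so that dominated convergence applies there. Away from `θ⋆` the
inequality `Vₙ ≤ V + κI` turns the separation condition into `Ψₙ ≥ cn`, outside the prior-null set
where `Vₙ` is singular; the kernel is at most `exp(-cn)π`, which beats the Jacobian `n^{d/2}` and the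
weight `‖ϑ‖` (`TypicalSeq.exists_far_bound`, `TypicalSeq.tendsto_integral_far`). All comparisons of
inverse matrices come from the variational formula `xᵀA⁻¹x = sup_y (2xᵀy - yᵀAy)`
(`two_inner_sub_quadForm_le`). Dividing by the normalising constants gives weighted `L¹`
convergence of the posterior density, and with it `√n(θ̄ - θ⋆) - Zₙ/√n → 0`.

**Probability.** If events `Bₙ` had probabilities not tending to zero, then along a subsequence they
would meet the likely events that make up the assumptions, uniform tightness of `ψₙ(θ⋆)/√n` included,
and a choice of data points would produce a typical sequence inside the `Bₙ`
(`tendsto_measure_zero_of_typicalSeq`). This needs no measurability of suprema. The limit law of the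
posterior mean then follows from that of `Zₙ/√n`, a linear image of `ψₙ(θ⋆)/√n`, by Slutsky's lemma.
-/

noncomputable section

namespace QPosterior

variable {d : ℕ}

/-! ### Quadratic forms -/

lemma quadForm_eq_inner (A : Matrix (Fin d) (Fin d) ℝ) (x : E d) :
    quadForm A x = inner ℝ x (WithLp.toLp 2 (A *ᵥ x.ofLp)) := by
  rw [EuclideanSpace.inner_eq_star_dotProduct]
  simp [quadForm, dotProduct_comm]

lemma norm_toLp_mulVec_le (A : Matrix (Fin d) (Fin d) ℝ) (x : E d) :
    ‖(WithLp.toLp 2 (A *ᵥ x.ofLp) : E d)‖ ≤ ‖A‖ * ‖x‖ :=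
  Matrix.l2_opNorm_mulVec A x

lemma quadForm_le_norm_mul (A : Matrix (Fin d) (Fin d) ℝ) (x : E d) :
    quadForm A x ≤ ‖A‖ * ‖x‖ ^ 2 := by
  rw [quadForm_eq_inner]
  calc _ ≤ ‖x‖ * ‖(WithLp.toLp 2 (A *ᵥ x.ofLp) : E d)‖ := real_inner_le_norm _ _
    _ ≤ ‖x‖ * (‖A‖ * ‖x‖) := by gcongr; exact norm_toLp_mulVec_le A x
    _ = _ := by ring

lemma quadForm_add (A B : Matrix (Fin d) (Fin d) ℝ) (x : E d) :
    quadForm (A + B) x = quadForm A x + quadForm B x := by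
  simp [quadForm, Matrix.add_mulVec, dotProduct_add]

lemma quadForm_smul_one (κ : ℝ) (x : E d) :
    quadForm (κ • (1 : Matrix (Fin d) (Fin d) ℝ)) x = κ * ‖x‖ ^ 2 := by
  rw [quadForm_eq_inner]
  simp [Matrix.smul_mulVec, inner_smul_right]

lemma quadForm_nonneg {A : Matrix (Fin d) (Fin d) ℝ} (hA : A.PosSemidef) (x : E d) :
    0 ≤ quadForm A x := by
  simpa [quadForm] using hA.dotProduct_mulVec_nonneg x.ofLp

/-- The variational bound behind all comparisons of inverse matrices: `xᵀA⁻¹x` is the supremum over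
`y` of `2 xᵀy - yᵀAy`. -/
lemma two_inner_sub_quadForm_le {A : Matrix (Fin d) (Fin d) ℝ} (hA : A.PosDef) (x y : E d) :
    2 * inner ℝ x y - quadForm A y ≤ quadForm A⁻¹ x := by
  have hdet : IsUnit A.det := (Matrix.isUnit_iff_isUnit_det A).1 hA.isUnit
  have hT : Aᵀ = A := by simpa using hA.isHermitian.eq
  -- expand the nonnegative quantity `(A⁻¹x - y)ᵀ A (A⁻¹x - y)`
  have h := hA.posSemidef.dotProduct_mulVec_nonneg (A⁻¹ *ᵥ x.ofLp - y.ofLp)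
  have h1 : A *ᵥ (A⁻¹ *ᵥ x.ofLp) = x.ofLp := by
    rw [Matrix.mulVec_mulVec, Matrix.mul_nonsing_inv _ hdet, Matrix.one_mulVec]
  have h2 : (A⁻¹ *ᵥ x.ofLp) ⬝ᵥ (A *ᵥ y.ofLp) = x.ofLp ⬝ᵥ y.ofLp := by
    rw [Matrix.dotProduct_mulVec, ← Matrix.mulVec_transpose, hT, h1]
  rw [Matrix.mulVec_sub, h1] at h
  simp only [star_trivial, sub_dotProduct, dotProduct_sub, h2] at h
  have h3 : inner ℝ x y = x.ofLp ⬝ᵥ y.ofLp := by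
    rw [EuclideanSpace.inner_eq_star_dotProduct, star_trivial, dotProduct_comm]
  rw [h3, quadForm, quadForm]
  rw [dotProduct_comm (A⁻¹ *ᵥ x.ofLp) x.ofLp, dotProduct_comm y.ofLp x.ofLp] at h
  linarith

lemma norm_sq_div_le_quadForm_inv {A : Matrix (Fin d) (Fin d) ℝ} (hA : A.PosDef) {Λ : ℝ}
    (hΛ : 0 < Λ) (hAΛ : ‖A‖ ≤ Λ) (x : E d) : ‖x‖ ^ 2 / Λ ≤ quadForm A⁻¹ x := by
  refine le_trans ?_ (two_inner_sub_quadForm_le hA x (Λ⁻¹ • x))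
  have h1 : quadForm A (Λ⁻¹ • x) ≤ Λ * ‖Λ⁻¹ • x‖ ^ 2 :=
    (quadForm_le_norm_mul _ _).trans (by gcongr)
  rw [norm_smul, Real.norm_eq_abs, abs_of_pos (inv_pos.2 hΛ)] at h1
  rw [inner_smul_right, real_inner_self_eq_norm_sq]
  have h2 : Λ * (Λ⁻¹ * ‖x‖) ^ 2 = ‖x‖ ^ 2 / Λ := by field_simp
  have h3 : Λ⁻¹ * ‖x‖ ^ 2 = ‖x‖ ^ 2 / Λ := by field_simp
  linarith

lemma exists_mul_norm_sq_le_quadForm {A : Matrix (Fin d) (Fin d) ℝ} (hA : A.PosDef) :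
    ∃ c : ℝ, 0 < c ∧ ∀ x : E d, c * ‖x‖ ^ 2 ≤ quadForm A x := by
  refine ⟨(‖A⁻¹‖ + 1)⁻¹, by positivity, fun x => ?_⟩
  have h := norm_sq_div_le_quadForm_inv hA.inv (Λ := ‖A⁻¹‖ + 1) (by positivity) (by linarith) x
  rw [Matrix.nonsing_inv_nonsing_inv _ ((Matrix.isUnit_iff_isUnit_det A).1 hA.isUnit)] at h
  rwa [inv_mul_eq_div]

/-- If `A` is within `κ` of `V`, the quadratic form of `A⁻¹` at a perturbation of `x` is bounded
below through that of `(V + κI)⁻¹` at `x`, because `A ≤ V + κI`. -/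
lemma half_quadForm_inv_sub_le {A V : Matrix (Fin d) (Fin d) ℝ} (hA : A.PosDef)
    (hV : V.PosSemidef) {κ : ℝ} (hκ : 0 < κ) (hAV : ‖A - V‖ ≤ κ) (x r : E d) :
    quadForm (V + κ • (1 : Matrix (Fin d) (Fin d) ℝ))⁻¹ x / 2 - 2 / κ * ‖r‖ ^ 2
      ≤ quadForm A⁻¹ (x + r) := by
  set B : Matrix (Fin d) (Fin d) ℝ := V + κ • 1 with hB
  have hBpos : B.PosDef := Matrix.PosDef.posSemidef_add hV (Matrix.PosDef.one.smul hκ)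
  have hdet : IsUnit B.det := (Matrix.isUnit_iff_isUnit_det B).1 hBpos.isUnit
  -- test the variational bound at `u = B⁻¹x`
  set u : E d := WithLp.toLp 2 (B⁻¹ *ᵥ x.ofLp) with hu
  have hQ : quadForm B u = quadForm B⁻¹ x := by
    simp only [quadForm, hu]
    rw [Matrix.mulVec_mulVec, Matrix.mul_nonsing_inv _ hdet, Matrix.one_mulVec, dotProduct_comm]
  have hxu : inner ℝ x u = quadForm B⁻¹ x := by rw [quadForm_eq_inner]
  have hκu : κ * ‖u‖ ^ 2 ≤ quadForm B⁻¹ x := by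
    rw [← hQ, hB, quadForm_add, quadForm_smul_one]
    linarith [quadForm_nonneg hV u]
  have hAB : quadForm A u ≤ quadForm B u := by
    have h1 : quadForm A u = quadForm V u + quadForm (A - V) u := by
      rw [← quadForm_add]; congr 1; abel
    have h2 : quadForm (A - V) u ≤ κ * ‖u‖ ^ 2 := (quadForm_le_norm_mul _ _).trans (by gcongr)
    rw [h1, hB, quadForm_add, quadForm_smul_one]
    linarith
  have hru : -(‖r‖ * ‖u‖) ≤ inner ℝ r u := by
    have := abs_real_inner_le_norm r u
    linarith [neg_abs_le (inner ℝ r u)]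
  have h := two_inner_sub_quadForm_le hA (x + r) u
  rw [inner_add_left, hxu] at h
  have hyoung : 2 * (‖r‖ * ‖u‖) ≤ κ * ‖u‖ ^ 2 / 2 + 2 / κ * ‖r‖ ^ 2 := by
    have h0 : 0 ≤ (κ * ‖u‖ - 2 * ‖r‖) ^ 2 / (2 * κ) := by positivity
    have h1 : (κ * ‖u‖ - 2 * ‖r‖) ^ 2 / (2 * κ)
        = κ * ‖u‖ ^ 2 / 2 + 2 / κ * ‖r‖ ^ 2 - 2 * (‖r‖ * ‖u‖) := by field_simp; ring
    linarith
  linarith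

lemma continuous_quadForm : Continuous fun p : Matrix (Fin d) (Fin d) ℝ × E d =>
    quadForm p.1 p.2 := by
  unfold quadForm
  have h : Continuous fun p : Matrix (Fin d) (Fin d) ℝ × E d => p.2.ofLp := by fun_prop
  exact h.dotProduct (continuous_fst.matrix_mulVec h)

lemma tendsto_matrix_inv {ι : Type*} {l : Filter ι} {A : ι → Matrix (Fin d) (Fin d) ℝ}
    {B : Matrix (Fin d) (Fin d) ℝ} (hB : IsUnit B) (h : Tendsto A l (𝓝 B)) :
    Tendsto (fun i => (A i)⁻¹) l (𝓝 B⁻¹) := by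
  have hdet : B.det ≠ 0 := ((Matrix.isUnit_iff_isUnit_det B).1 hB).ne_zero
  simp only [Matrix.inv_def, Ring.inverse_eq_inv']
  have h1 : Tendsto (fun i => (A i).det) l (𝓝 B.det) :=
    (continuous_id.matrix_det.tendsto B).comp h
  have h2 : Tendsto (fun i => (A i).adjugate) l (𝓝 B.adjugate) :=
    (continuous_id.matrix_adjugate.tendsto B).comp h
  exact (h1.inv₀ hdet).smul h2

/-! ### The Jacobian and the recentring map -/

lemma fderiv_apply_eq_jacobian (ψ : E d → E d) (θ x : E d) :
    fderiv ℝ ψ θ x = WithLp.toLp 2 (jacobian ψ θ *ᵥ x.ofLp) := by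
  have hx : x = ∑ j, x j • EuclideanSpace.single j (1 : ℝ) := by
    ext i
    simp [Finset.sum_apply, Pi.single_apply]
  conv_lhs => rw [hx]
  ext i
  simp [jacobian, Matrix.mulVec, dotProduct, mul_comm]

lemma quadForm_inv_fderiv (ψ : E d → E d) (V : E d → Matrix (Fin d) (Fin d) ℝ) (θ x : E d) :
    quadForm (V θ)⁻¹ (fderiv ℝ ψ θ x) = quadForm (OmegaStar ψ V θ) x := by
  rw [fderiv_apply_eq_jacobian]
  simp only [quadForm, OmegaStar]
  rw [← Matrix.mulVec_mulVec, ← Matrix.mulVec_mulVec, Matrix.dotProduct_mulVec x.ofLp,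
    Matrix.vecMul_transpose]

lemma posDef_OmegaStar {ψ : E d → E d} {V : E d → Matrix (Fin d) (Fin d) ℝ} {θ : E d}
    (hV : (V θ).PosDef) (hJ : IsUnit (jacobian ψ θ)) : (OmegaStar ψ V θ).PosDef := by
  have h := hV.inv.conjTranspose_mul_mul_same (B := jacobian ψ θ)
    (Matrix.mulVec_injective_of_isUnit hJ)
  simpa [OmegaStar] using h

lemma recentring_matrix_eq {ψ : E d → E d} {V : E d → Matrix (Fin d) (Fin d) ℝ} {θ : E d}
    (hV : (V θ).PosDef) (hJ : IsUnit (jacobian ψ θ)) :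
    (OmegaStar ψ V θ)⁻¹ * (jacobian ψ θ)ᵀ * (V θ)⁻¹ = (jacobian ψ θ)⁻¹ := by
  have hdJ : IsUnit (jacobian ψ θ).det := (Matrix.isUnit_iff_isUnit_det _).1 hJ
  have hdO : IsUnit (OmegaStar ψ V θ).det :=
    (Matrix.isUnit_iff_isUnit_det _).1 (posDef_OmegaStar hV hJ).isUnit
  calc _ = (OmegaStar ψ V θ)⁻¹ * ((jacobian ψ θ)ᵀ * (V θ)⁻¹ * jacobian ψ θ)
        * (jacobian ψ θ)⁻¹ := by
        simp only [Matrix.mul_assoc]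
        rw [Matrix.mul_nonsing_inv _ hdJ, Matrix.mul_one]
    _ = _ := by
        rw [← OmegaStar, Matrix.nonsing_inv_mul _ hdO, Matrix.one_mul]

/-- As `∇ψ(θ⋆)` is invertible, the recentring vector is `-∇ψ(θ⋆)⁻¹ψₙ(θ⋆)`. -/
lemma recentring_eq {ψ : E d → E d} {V : E d → Matrix (Fin d) (Fin d) ℝ} {θ : E d}
    (hV : (V θ).PosDef) (hJ : IsUnit (jacobian ψ θ)) (s : E d) :
    recentring ψ V θ s = -WithLp.toLp 2 ((jacobian ψ θ)⁻¹ *ᵥ s.ofLp) := by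
  rw [recentring, recentring_matrix_eq hV hJ]

lemma fderiv_recentring {ψ : E d → E d} {V : E d → Matrix (Fin d) (Fin d) ℝ} {θ : E d}
    (hV : (V θ).PosDef) (hJ : IsUnit (jacobian ψ θ)) (s : E d) :
    fderiv ℝ ψ θ (recentring ψ V θ s) = -s := by
  rw [recentring_eq hV hJ, map_neg, fderiv_apply_eq_jacobian]
  rw [Matrix.mulVec_mulVec, Matrix.mul_nonsing_inv _ ((Matrix.isUnit_iff_isUnit_det _).1 hJ),
    Matrix.one_mulVec]

lemma recentring_smul (ψ : E d → E d) (V : E d → Matrix (Fin d) (Fin d) ℝ) (θ : E d) (c : ℝ)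
    (s : E d) : recentring ψ V θ (c • s) = c • recentring ψ V θ s := by
  simp [recentring, Matrix.mulVec_smul]

lemma norm_le_norm_fderiv {ψ : E d → E d} {θ : E d} (hJ : IsUnit (jacobian ψ θ)) :
    ∃ g : ℝ, 0 < g ∧ ∀ x, g * ‖x‖ ≤ ‖fderiv ℝ ψ θ x‖ := by
  refine ⟨(‖(jacobian ψ θ)⁻¹‖ + 1)⁻¹, by positivity, fun x => ?_⟩
  have h := norm_toLp_mulVec_le (jacobian ψ θ)⁻¹ (fderiv ℝ ψ θ x)
  have hx : (WithLp.toLp 2 ((jacobian ψ θ)⁻¹ *ᵥ (fderiv ℝ ψ θ x).ofLp) : E d) = x := by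
    rw [fderiv_apply_eq_jacobian]
    rw [Matrix.mulVec_mulVec, Matrix.nonsing_inv_mul _ ((Matrix.isUnit_iff_isUnit_det _).1 hJ),
      Matrix.one_mulVec]
  rw [hx] at h
  rw [inv_mul_le_iff₀ (by positivity)]
  nlinarith [norm_nonneg (fderiv ℝ ψ θ x)]

/-! ### Asymptotics of the kernel along typical sequences -/

/-- The properties of the non-random objects `Θ`, `ψ`, `V`, `π` and `θ⋆` on which the posterior
asymptotics rest. -/
structure LimitModel (Θ : Set (E d)) (ψ : E d → E d) (V : E d → Matrix (Fin d) (Fin d) ℝ)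
    (π : E d → ℝ) (θstar : E d) : Prop where
  measurableSet : MeasurableSet Θ
  mem_nhds : Θ ∈ 𝓝 θstar
  differentiableAt : DifferentiableAt ℝ ψ θstar
  invertible : IsUnit (jacobian ψ θstar)
  posSemidef : ∀ θ ∈ Θ, (V θ).PosSemidef
  posDef_star : (V θstar).PosDef
  continuousAt : ContinuousAt V θstar
  separated : ∀ ε : ℝ, 0 < ε → ∃ κ : ℝ, 0 < κ ∧ ∃ c : ℝ, 0 < c ∧
    ∀ θ ∈ Θ, ε ≤ ‖θ - θstar‖ → c ≤ quadForm (V θ + κ • 1)⁻¹ (ψ θ)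
  prior_nonneg : ∀ θ ∈ Θ, 0 ≤ π θ
  prior_pos : 0 < π θstar
  prior_continuousAt : ContinuousAt π θstar
  prior_integrable : IntegrableOn π Θ
  prior_moment : IntegrableOn (fun θ => ‖θ‖ * π θ) Θ

/-- A weight matrix function at a fixed data point which is positive semi-definite on `Θ` and
singular only on a null set of the prior, together with measurability of the posterior kernel. The
point `θ⋆` is exempted because for `d = 0` it is not a null set. -/
structure Admissible (Θ : Set (E d)) (π : E d → ℝ) (θstar : E d) (n : ℕ) (s : E d → E d)
    (v : E d → Matrix (Fin d) (Fin d) ℝ) : Prop where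
  posSemidef : ∀ θ ∈ Θ, (v θ).PosSemidef
  posDef_ae : ∀ᵐ θ ∂volume.restrict Θ, π θ = 0 ∨ θ = θstar ∨ (v θ).PosDef
  aestronglyMeasurable : AEStronglyMeasurable (kernel n s v π) (volume.restrict Θ)

/-- A sequence of data points, with sample sizes `n k`, estimating functions `s k` and weights `v k`,
along which the stochastic assumptions hold in their deterministic form. -/
structure TypicalSeq (Θ : Set (E d)) (ψ : E d → E d) (V : E d → Matrix (Fin d) (Fin d) ℝ)
    (π : E d → ℝ) (θstar : E d) (n : ℕ → ℕ) (s : ℕ → E d → E d)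
    (v : ℕ → E d → Matrix (Fin d) (Fin d) ℝ) : Prop where
  tendsto_size : Tendsto n atTop atTop
  admissible : ∀ k, Admissible Θ π θstar (n k) (s k) (v k)
  posDef_near : ∃ δ : ℝ, 0 < δ ∧ ∀ k, ∀ θ ∈ Θ, ‖θ - θstar‖ ≤ δ → (v k θ).PosDef
  uniform : ∀ ε : ℝ, 0 < ε → ∀ᶠ k in atTop, ∀ θ ∈ Θ, ‖(n k : ℝ)⁻¹ • s k θ - ψ θ‖ ≤ ε
  weight_uniform : ∀ ε : ℝ, 0 < ε → ∀ᶠ k in atTop, ∀ θ ∈ Θ, ‖v k θ - V θ‖ ≤ ε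
  equicontinuous : ∀ ε : ℝ, 0 < ε → ∃ δ : ℝ, 0 < δ ∧ ∀ᶠ k in atTop, ∀ θ ∈ Θ,
    ‖θ - θstar‖ < δ →
      Real.sqrt (n k) * ‖(n k : ℝ)⁻¹ • (s k θ - s k θstar) - (ψ θ - ψ θstar)‖ ≤
        ε * (1 + Real.sqrt (n k) * ‖θ - θstar‖)
  bounded : ∃ M : ℝ, ∀ k, ‖(Real.sqrt (n k))⁻¹ • s k θstar‖ ≤ M

/-- The parameter `θ⋆ + Z/n + ϑ/√n` with local coordinate `ϑ`. -/
def localPoint (n : ℕ) (θstar Z ϑ : E d) : E d :=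
  θstar + (n : ℝ)⁻¹ • Z + (Real.sqrt n)⁻¹ • ϑ

/-- The unnormalised posterior in the local coordinate, extended by zero outside `Θ`. -/
def localKernel (Θ : Set (E d)) (n : ℕ) (s : E d → E d) (v : E d → Matrix (Fin d) (Fin d) ℝ)
    (π : E d → ℝ) (θstar Z ϑ : E d) : ℝ :=
  Θ.indicator (kernel n s v π) (localPoint n θstar Z ϑ)

/-- The limit `π(θ⋆) exp(-½ ϑᵀΩ⋆ϑ)` of the local kernels. -/
def limitKernel (ψ : E d → E d) (V : E d → Matrix (Fin d) (Fin d) ℝ) (π : E d → ℝ)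
    (θstar ϑ : E d) : ℝ :=
  Real.exp (-(1 / 2 * quadForm (OmegaStar ψ V θstar) ϑ)) * π θstar

variable {Θ : Set (E d)} {ψ : E d → E d} {V : E d → Matrix (Fin d) (Fin d) ℝ} {π : E d → ℝ}
  {θstar : E d}

section Kernel

variable {n : ℕ} {s : E d → E d} {v : E d → Matrix (Fin d) (Fin d) ℝ}

lemma kernel_nonneg (hπ : ∀ θ ∈ Θ, 0 ≤ π θ) {θ : E d} (hθ : θ ∈ Θ) : 0 ≤ kernel n s v π θ :=
  mul_nonneg (Real.exp_nonneg _) (hπ θ hθ)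

lemma kernel_le_prior (hπ : ∀ θ ∈ Θ, 0 ≤ π θ) (hv : ∀ θ ∈ Θ, (v θ).PosSemidef) {θ : E d}
    (hθ : θ ∈ Θ) : kernel n s v π θ ≤ π θ := by
  have h : 0 ≤ criterion n s v θ :=
    mul_nonneg (by norm_num) (quadForm_nonneg (hv θ hθ).inv _)
  calc kernel n s v π θ ≤ 1 * π θ :=
        mul_le_mul_of_nonneg_right (Real.exp_le_one_iff.2 (by linarith)) (hπ θ hθ)
    _ = π θ := one_mul _

lemma LimitModel.integrableOn_kernel (hL : LimitModel Θ ψ V π θstar)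
    (ha : Admissible Θ π θstar n s v) : IntegrableOn (kernel n s v π) Θ := by
  refine hL.prior_integrable.mono' ha.aestronglyMeasurable ?_
  refine (ae_restrict_iff' hL.measurableSet).2 (ae_of_all _ fun θ hθ => ?_)
  rw [Real.norm_eq_abs, abs_of_nonneg (kernel_nonneg hL.prior_nonneg hθ)]
  exact kernel_le_prior hL.prior_nonneg ha.posSemidef hθ

lemma LimitModel.integrableOn_kernel_smul (hL : LimitModel Θ ψ V π θstar)
    (ha : Admissible Θ π θstar n s v) : IntegrableOn (fun θ => kernel n s v π θ • θ) Θ := by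
  refine hL.prior_moment.mono' (ha.aestronglyMeasurable.smul aestronglyMeasurable_id) ?_
  refine (ae_restrict_iff' hL.measurableSet).2 (ae_of_all _ fun θ hθ => ?_)
  rw [norm_smul, Real.norm_eq_abs, abs_of_nonneg (kernel_nonneg hL.prior_nonneg hθ), mul_comm]
  gcongr
  exact kernel_le_prior hL.prior_nonneg ha.posSemidef hθ

lemma LimitModel.integral_kernel_pos (hL : LimitModel Θ ψ V π θstar)
    (ha : Admissible Θ π θstar n s v) : 0 < ∫ θ in Θ, kernel n s v π θ := by
  have h0 : 0 ≤ᵐ[volume.restrict Θ] kernel n s v π :=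
    (ae_restrict_iff' hL.measurableSet).2 (ae_of_all _ fun θ hθ => kernel_nonneg hL.prior_nonneg hθ)
  rw [setIntegral_pos_iff_support_of_nonneg_ae h0 (hL.integrableOn_kernel ha)]
  -- the kernel is positive wherever the prior is, in particular near `θ⋆`
  have h1 : (Function.support (kernel n s v π) ∩ Θ) ∈ 𝓝 θstar := by
    filter_upwards [hL.mem_nhds, hL.prior_continuousAt.eventually_ne hL.prior_pos.ne'] with θ h1 h2
    exact ⟨mul_ne_zero (Real.exp_pos _).ne' h2, h1⟩
  exact Measure.measure_pos_of_mem_nhds volume h1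

lemma LimitModel.integrableOn_posterior_smul (hL : LimitModel Θ ψ V π θstar)
    (ha : Admissible Θ π θstar n s v) :
    IntegrableOn (fun θ => posterior Θ n s v π θ • θ) Θ := by
  have h := (hL.integrableOn_kernel_smul ha).smul (∫ θ' in Θ, kernel n s v π θ')⁻¹
  refine h.congr (ae_of_all _ fun θ => ?_)
  simp only [posterior, Pi.smul_apply, smul_smul]
  congr 1
  ring

end Kernel

lemma sqrt_natCast_inv_mul_inv (n : ℕ) : (Real.sqrt n)⁻¹ * (Real.sqrt n)⁻¹ = (n : ℝ)⁻¹ := by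
  rw [← mul_inv, Real.mul_self_sqrt n.cast_nonneg]

lemma localPoint_sub (n : ℕ) (θstar Z ϑ : E d) :
    localPoint n θstar Z ϑ - θstar = (Real.sqrt n)⁻¹ • ((Real.sqrt n)⁻¹ • Z + ϑ) := by
  rw [localPoint, smul_add, smul_smul, sqrt_natCast_inv_mul_inv]
  abel

lemma sqrt_smul_localPoint_sub {n : ℕ} (hn : n ≠ 0) (θstar Z ϑ : E d) :
    Real.sqrt n • (localPoint n θstar Z ϑ - θstar) = (Real.sqrt n)⁻¹ • Z + ϑ := by
  have : Real.sqrt n ≠ 0 := (Real.sqrt_pos.2 (by positivity)).ne'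
  rw [localPoint_sub, smul_smul, mul_inv_cancel₀ this, one_smul]

section Sequence

variable {n : ℕ → ℕ} {s : ℕ → E d → E d} {v : ℕ → E d → Matrix (Fin d) (Fin d) ℝ}

lemma TypicalSeq.eventually_ne_zero (hS : TypicalSeq Θ ψ V π θstar n s v) :
    ∀ᶠ k in atTop, n k ≠ 0 :=
  hS.tendsto_size.eventually_ne_atTop 0

lemma TypicalSeq.tendsto_sqrt (hS : TypicalSeq Θ ψ V π θstar n s v) :
    Tendsto (fun k => Real.sqrt (n k)) atTop atTop :=
  Real.tendsto_sqrt_atTop.comp (tendsto_natCast_atTop_atTop.comp hS.tendsto_size)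

lemma TypicalSeq.exists_recentring_bound (hS : TypicalSeq Θ ψ V π θstar n s v) :
    ∃ M : ℝ, 0 ≤ M ∧
      ∀ k, ‖(Real.sqrt (n k))⁻¹ • recentring ψ V θstar (s k θstar)‖ ≤ M := by
  obtain ⟨M, hM⟩ := hS.bounded
  set A := (OmegaStar ψ V θstar)⁻¹ * (jacobian ψ θstar)ᵀ * (V θstar)⁻¹ with hA
  have hM0 : 0 ≤ M := (norm_nonneg _).trans (hM 0)
  refine ⟨‖A‖ * M, by positivity, fun k => ?_⟩
  rw [← recentring_smul, recentring, norm_neg]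
  exact (norm_toLp_mulVec_le A _).trans (by gcongr; exact hM k)

/-- Linearisation of the estimating function: in the local coordinate it is `∇ψ(θ⋆)ϑ`, up to a
small multiple of `1 + √n‖θ - θ⋆‖`, on a fixed neighbourhood of `θ⋆`. -/
lemma TypicalSeq.linearisation (hS : TypicalSeq Θ ψ V π θstar n s v)
    (hL : LimitModel Θ ψ V π θstar) {ε : ℝ} (hε : 0 < ε) :
    ∃ δ : ℝ, 0 < δ ∧ ∀ᶠ k in atTop, ∀ ϑ : E d,
      ‖localPoint (n k) θstar (recentring ψ V θstar (s k θstar)) ϑ - θstar‖ < δ →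
      ‖(Real.sqrt (n k))⁻¹ • s k (localPoint (n k) θstar (recentring ψ V θstar (s k θstar)) ϑ)
          - fderiv ℝ ψ θstar ϑ‖ ≤
        ε * (1 + ‖(Real.sqrt (n k))⁻¹ • recentring ψ V θstar (s k θstar) + ϑ‖) := by
  obtain ⟨δ₁, hδ₁, h₁⟩ := hS.equicontinuous (ε / 2) (by positivity)
  have hd := hL.differentiableAt.hasFDerivAt.isLittleO.def (c := ε / 2) (by positivity)
  obtain ⟨δ₂, hδ₂, h₂⟩ := Metric.eventually_nhds_iff.1 (hd.and hL.mem_nhds)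
  refine ⟨min δ₁ δ₂, by positivity, ?_⟩
  filter_upwards [h₁, hS.eventually_ne_zero] with k hk hn ϑ hϑ
  set Z := recentring ψ V θstar (s k θstar) with hZ
  set r := Real.sqrt (n k) with hr
  have hr0 : 0 < r := Real.sqrt_pos.2 (by positivity)
  have hrn : r * (n k : ℝ)⁻¹ = r⁻¹ := by
    rw [← sqrt_natCast_inv_mul_inv, ← hr]; field_simp
  set θ := localPoint (n k) θstar Z ϑ with hθ
  have hh : r • (θ - θstar) = r⁻¹ • Z + ϑ := sqrt_smul_localPoint_sub hn _ _ _
  have hnorm : r * ‖θ - θstar‖ = ‖r⁻¹ • Z + ϑ‖ := by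
    rw [← hh, norm_smul, Real.norm_eq_abs, abs_of_pos hr0]
  obtain ⟨hb, hmem⟩ := h₂ (y := θ) (by rw [dist_eq_norm]; exact hϑ.trans_le (min_le_right _ _))
  have ha := hk θ hmem (hϑ.trans_le (min_le_left _ _))
  have hLh : fderiv ℝ ψ θstar (r • (θ - θstar)) = fderiv ℝ ψ θstar ϑ - r⁻¹ • s k θstar := by
    rw [hh, map_add, map_smul, fderiv_recentring hL.posDef_star hL.invertible]
    rw [smul_neg]; abel
  have hsplit : r⁻¹ • s k θ - fderiv ℝ ψ θstar ϑ
      = r • ((n k : ℝ)⁻¹ • (s k θ - s k θstar) - (ψ θ - ψ θstar))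
        + r • (ψ θ - ψ θstar - fderiv ℝ ψ θstar (θ - θstar)) := by
    rw [smul_sub r (ψ θ - ψ θstar) (fderiv ℝ ψ θstar (θ - θstar)), ← map_smul, hLh, smul_sub r,
      smul_smul, hrn, smul_sub r⁻¹]
    abel
  rw [hsplit]
  refine (norm_add_le _ _).trans ?_
  rw [norm_smul, norm_smul, Real.norm_eq_abs, abs_of_pos hr0]
  have hb' : r * ‖ψ θ - ψ θstar - fderiv ℝ ψ θstar (θ - θstar)‖ ≤ ε / 2 * ‖r⁻¹ • Z + ϑ‖ := by
    rw [← hnorm]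
    calc _ ≤ r * (ε / 2 * ‖θ - θstar‖) := by gcongr
      _ = _ := by ring
  rw [hnorm] at ha
  nlinarith

lemma TypicalSeq.tendsto_localPoint (hS : TypicalSeq Θ ψ V π θstar n s v) (ϑ : E d) :
    Tendsto (fun k => localPoint (n k) θstar (recentring ψ V θstar (s k θstar)) ϑ) atTop
      (𝓝 θstar) := by
  obtain ⟨M, hM0, hM⟩ := hS.exists_recentring_bound
  rw [tendsto_iff_norm_sub_tendsto_zero]
  have h : Tendsto (fun k => (Real.sqrt (n k))⁻¹ * (M + ‖ϑ‖)) atTop (𝓝 0) := by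
    simpa using hS.tendsto_sqrt.inv_tendsto_atTop.mul_const (M + ‖ϑ‖)
  refine squeeze_zero (fun _ => norm_nonneg _) (fun k => ?_) h
  rw [localPoint_sub, norm_smul, norm_inv, Real.norm_of_nonneg (Real.sqrt_nonneg _)]
  gcongr
  exact (norm_add_le _ _).trans (by gcongr; exact hM k)

lemma TypicalSeq.tendsto_localKernel (hS : TypicalSeq Θ ψ V π θstar n s v)
    (hL : LimitModel Θ ψ V π θstar) (ϑ : E d) :
    Tendsto (fun k => localKernel Θ (n k) (s k) (v k) π θstar
      (recentring ψ V θstar (s k θstar)) ϑ) atTop (𝓝 (limitKernel ψ V π θstar ϑ)) := by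
  set p : ℕ → E d := fun k => localPoint (n k) θstar (recentring ψ V θstar (s k θstar)) ϑ with hp
  have hpt : Tendsto p atTop (𝓝 θstar) := hS.tendsto_localPoint ϑ
  obtain ⟨M, hM0, hM⟩ := hS.exists_recentring_bound
  have hmem : ∀ᶠ k in atTop, p k ∈ Θ := hpt.eventually hL.mem_nhds
  have hs : Tendsto (fun k => (Real.sqrt (n k))⁻¹ • s k (p k)) atTop
      (𝓝 (fderiv ℝ ψ θstar ϑ)) := by
    rw [tendsto_iff_norm_sub_tendsto_zero, Metric.tendsto_nhds]
    intro ε hε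
    have hB : 0 < 1 + (M + ‖ϑ‖) := by positivity
    obtain ⟨δ, hδ, hlin⟩ := hS.linearisation hL (ε := ε / 2 / (1 + (M + ‖ϑ‖))) (by positivity)
    filter_upwards [hlin, hpt.eventually (Metric.ball_mem_nhds θstar hδ)] with k h1 h2
    have h3 := h1 ϑ (by simpa [dist_eq_norm] using h2)
    simp only [dist_zero_right, norm_norm]
    refine h3.trans_lt ?_
    calc _ ≤ ε / 2 / (1 + (M + ‖ϑ‖)) * (1 + (M + ‖ϑ‖)) := by
            gcongr
            exact (norm_add_le _ _).trans (by gcongr; exact hM k)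
      _ = ε / 2 := by field_simp
      _ < ε := by linarith
  have hv : Tendsto (fun k => v k (p k)) atTop (𝓝 (V θstar)) := by
    have h1 : Tendsto (fun k => v k (p k) - V (p k)) atTop (𝓝 0) := by
      rw [tendsto_zero_iff_norm_tendsto_zero, Metric.tendsto_nhds]
      intro ε hε
      filter_upwards [hS.weight_uniform (ε / 2) (by positivity), hmem] with k h1 h2
      simp only [dist_zero_right, norm_norm]
      linarith [h1 _ h2]
    simpa using h1.add (hL.continuousAt.tendsto.comp hpt)
  have hq := (continuous_quadForm.tendsto _).comp
    ((tendsto_matrix_inv hL.posDef_star.isUnit hv).prodMk_nhds hs)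
  have hlim := (((hq.const_mul (1 / 2)).neg).rexp).mul (hL.prior_continuousAt.tendsto.comp hpt)
  simp only [quadForm_inv_fderiv] at hlim
  refine hlim.congr' ?_
  filter_upwards [hmem] with k hk
  rw [localKernel, Set.indicator_of_mem hk]
  rfl

/-- Near `θ⋆` the local kernels are dominated by a Gaussian function. -/
lemma TypicalSeq.exists_gaussian_bound (hS : TypicalSeq Θ ψ V π θstar n s v)
    (hL : LimitModel Θ ψ V π θstar) :
    ∃ δ C a : ℝ, 0 < δ ∧ 0 ≤ C ∧ 0 < a ∧ ∀ᶠ k in atTop, ∀ ϑ : E d,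
      ‖localPoint (n k) θstar (recentring ψ V θstar (s k θstar)) ϑ - θstar‖ < δ →
      localKernel Θ (n k) (s k) (v k) π θstar (recentring ψ V θstar (s k θstar)) ϑ
        ≤ C * Real.exp (-a * ‖ϑ‖ ^ 2) := by
  obtain ⟨M, hM0, hM⟩ := hS.exists_recentring_bound
  obtain ⟨g, hg, hgL⟩ := norm_le_norm_fderiv hL.invertible
  -- an error below `g / 4` leaves half of the lower bound `g‖ϑ‖` for `‖∇ψ(θ⋆)ϑ‖`
  obtain ⟨δ₁, hδ₁, h₁⟩ := hS.linearisation hL (ε := g / 4) (by positivity)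
  obtain ⟨δ₂, hδ₂, h₂⟩ := hS.posDef_near
  set Λ : ℝ := ‖V θstar‖ + 2 with hΛ
  have hΛ0 : 0 < Λ := by positivity
  have hnear : ∀ᶠ θ in 𝓝 θstar, θ ∈ Θ ∧ ‖V θ‖ < ‖V θstar‖ + 1 ∧ π θ < π θstar + 1 :=
    Filter.Eventually.and hL.mem_nhds ((hL.continuousAt.norm.eventually_lt_const (by linarith)).and
      (hL.prior_continuousAt.eventually_lt_const (by linarith)))
  obtain ⟨δ₃, hδ₃, h₃⟩ := Metric.eventually_nhds_iff.1 hnear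
  set B : ℝ := g / 4 * (1 + M) with hB
  refine ⟨min δ₁ (min δ₂ δ₃), Real.exp (B ^ 2 / (2 * Λ)) * (π θstar + 1), g ^ 2 / (16 * Λ),
    by positivity, mul_nonneg (Real.exp_nonneg _) (by linarith [hL.prior_pos]), by positivity, ?_⟩
  filter_upwards [h₁, hS.weight_uniform 1 one_pos] with k hk hw ϑ hϑ
  set θ := localPoint (n k) θstar (recentring ψ V θstar (s k θstar)) ϑ with hθ
  have hθ₂ : ‖θ - θstar‖ < δ₂ := hϑ.trans_le ((min_le_right _ _).trans (min_le_left _ _))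
  have hθ₃ : ‖θ - θstar‖ < δ₃ := hϑ.trans_le ((min_le_right _ _).trans (min_le_right _ _))
  obtain ⟨hmem, hVθ, hπθ⟩ := h₃ (y := θ) (by rwa [dist_eq_norm])
  have hπ0 := hL.prior_nonneg θ hmem
  have hvΛ : ‖v k θ‖ ≤ Λ := by
    have h1 : ‖v k θ‖ ≤ ‖v k θ - V θ‖ + ‖V θ‖ := by
      simpa using norm_add_le (v k θ - V θ) (V θ)
    linarith [hw θ hmem]
  set x := (Real.sqrt (n k))⁻¹ • s k θ with hx
  have hq := norm_sq_div_le_quadForm_inv (h₂ k θ hmem hθ₂.le) hΛ0 hvΛ x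
  have hx1 : g / 2 * ‖ϑ‖ ≤ ‖x‖ + B := by
    have h1 := hk ϑ (hϑ.trans_le (min_le_left _ _))
    have h2 : ‖fderiv ℝ ψ θstar ϑ‖ ≤ ‖x‖ + ‖x - fderiv ℝ ψ θstar ϑ‖ := by
      rw [norm_sub_rev]
      exact norm_le_norm_add_norm_sub' _ _
    have h3 : ‖(Real.sqrt (n k))⁻¹ • recentring ψ V θstar (s k θstar) + ϑ‖ ≤ M + ‖ϑ‖ :=
      (norm_add_le _ _).trans (by gcongr; exact hM k)
    have h4 : g / 4 * (1 + ‖(Real.sqrt (n k))⁻¹ • recentring ψ V θstar (s k θstar) + ϑ‖)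
        ≤ g / 4 * (1 + (M + ‖ϑ‖)) := by gcongr
    have := hgL ϑ
    have h5 := norm_nonneg ϑ
    rw [hB]
    nlinarith
  have hx2 : g ^ 2 / 4 * ‖ϑ‖ ^ 2 ≤ 2 * ‖x‖ ^ 2 + 2 * B ^ 2 := by
    have h0 : 0 ≤ g / 2 * ‖ϑ‖ := by positivity
    have h1 := pow_le_pow_left₀ h0 hx1 2
    nlinarith [sq_nonneg (‖x‖ - B)]
  have hcrit : g ^ 2 / (16 * Λ) * ‖ϑ‖ ^ 2 - B ^ 2 / (2 * Λ) ≤ criterion (n k) (s k) (v k) θ := by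
    have h1 : g ^ 2 / (16 * Λ) * ‖ϑ‖ ^ 2 - B ^ 2 / (2 * Λ)
        = (g ^ 2 / 4 * ‖ϑ‖ ^ 2 - 2 * B ^ 2) / (4 * Λ) := by field_simp; ring
    have h2 : (g ^ 2 / 4 * ‖ϑ‖ ^ 2 - 2 * B ^ 2) / (4 * Λ) ≤ 2 * ‖x‖ ^ 2 / (4 * Λ) := by
      gcongr; linarith
    have h3 : 2 * ‖x‖ ^ 2 / (4 * Λ) = 1 / 2 * (‖x‖ ^ 2 / Λ) := by field_simp; ring
    rw [h1, criterion]
    linarith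
  rw [localKernel, Set.indicator_of_mem hmem, kernel]
  calc _ ≤ Real.exp (B ^ 2 / (2 * Λ) + -(g ^ 2 / (16 * Λ)) * ‖ϑ‖ ^ 2) * (π θstar + 1) := by
        gcongr
        linarith
    _ = _ := by rw [Real.exp_add]; ring

/-- Away from `θ⋆` the kernel is exponentially small relative to the prior. -/
lemma TypicalSeq.exists_far_bound (hS : TypicalSeq Θ ψ V π θstar n s v)
    (hL : LimitModel Θ ψ V π θstar) {δ : ℝ} (hδ : 0 < δ) :
    ∃ c : ℝ, 0 < c ∧ ∀ᶠ k in atTop, ∀ᵐ θ ∂volume.restrict Θ, δ ≤ ‖θ - θstar‖ →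
      kernel (n k) (s k) (v k) π θ ≤ Real.exp (-c * n k) * π θ := by
  obtain ⟨κ, hκ, c, hc, hsep⟩ := hL.separated δ hδ
  -- with `‖ψₙ/n - ψ‖² ≤ cκ/8` the perturbation costs at most `c/4` of the available `c/2`
  have hη : 0 < Real.sqrt (c * κ / 8) := Real.sqrt_pos.2 (by positivity)
  refine ⟨c / 8, by positivity, ?_⟩
  filter_upwards [hS.uniform _ hη, hS.weight_uniform κ hκ, hS.eventually_ne_zero] with k h1 h2 hn
  filter_upwards [(hS.admissible k).posDef_ae, ae_restrict_mem hL.measurableSet] with θ h3 hθ hfar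
  rcases h3 with h3 | h3 | h3
  · simp [kernel, h3]
  · rw [h3] at hfar
    simp at hfar
    linarith
  have hπ0 := hL.prior_nonneg θ hθ
  rw [kernel]
  gcongr
  have hr0 : 0 < Real.sqrt (n k) := Real.sqrt_pos.2 (by positivity)
  set e := (n k : ℝ)⁻¹ • s k θ - ψ θ with he
  have hq := half_quadForm_inv_sub_le h3 (hL.posSemidef θ hθ) hκ (h2 θ hθ) (ψ θ) e
  have he2 : ‖e‖ ^ 2 ≤ c * κ / 8 := by
    have := pow_le_pow_left₀ (norm_nonneg _) (h1 θ hθ) 2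
    rwa [Real.sq_sqrt (by positivity)] at this
  have he3 : 2 / κ * ‖e‖ ^ 2 ≤ c / 4 := by
    calc _ ≤ 2 / κ * (c * κ / 8) := by gcongr
      _ = c / 4 := by field_simp; ring
  have hsep' := hsep θ hθ hfar
  -- `ψₙ/√n = √n (ψ + e)`, and the quadratic form is homogeneous of degree two
  have hscale : quadForm (v k θ)⁻¹ ((Real.sqrt (n k))⁻¹ • s k θ)
      = n k * quadForm (v k θ)⁻¹ (ψ θ + e) := by
    have h4 : (Real.sqrt (n k))⁻¹ • s k θ = Real.sqrt (n k) • (ψ θ + e) := by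
      rw [he, add_sub_cancel, smul_smul, ← sqrt_natCast_inv_mul_inv]
      congr 1
      field_simp
    rw [h4]
    simp only [quadForm, WithLp.ofLp_smul, Matrix.mulVec_smul, smul_dotProduct, dotProduct_smul,
      smul_eq_mul]
    rw [← mul_assoc, Real.mul_self_sqrt (Nat.cast_nonneg _)]
  rw [criterion, hscale]
  have hn0 : (0 : ℝ) ≤ n k := Nat.cast_nonneg _
  have : (n k : ℝ) * (c / 4) ≤ n k * quadForm (v k θ)⁻¹ (ψ θ + e) := by
    gcongr
    linarith
  linarith

end Sequence

/-! ### Gaussian integrals -/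

lemma integrable_exp_neg_mul_norm_sq {a : ℝ} (ha : 0 < a) :
    Integrable fun x : E d => Real.exp (-a * ‖x‖ ^ 2) := by
  -- a function with nonzero Bochner integral is integrable
  by_contra h
  have h1 := GaussianFourier.integral_rexp_neg_mul_sq_norm (V := E d) ha
  rw [integral_undef h] at h1
  have : 0 < (Real.pi / a) ^ (Module.finrank ℝ (E d) / 2 : ℝ) := by positivity
  linarith

lemma integrable_one_add_norm_mul_exp_neg {a : ℝ} (ha : 0 < a) :
    Integrable fun x : E d => (1 + ‖x‖) * Real.exp (-a * ‖x‖ ^ 2) := by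
  have h := (integrable_exp_neg_mul_norm_sq (d := d) (a := a / 2) (by positivity)).const_mul
    (1 + 1 / (2 * a))
  refine h.mono' (by fun_prop) (ae_of_all _ fun x => ?_)
  rw [Real.norm_of_nonneg (by positivity)]
  have h1 : 1 + ‖x‖ ≤ (1 + 1 / (2 * a)) * Real.exp (a / 2 * ‖x‖ ^ 2) := by
    have h2 : a / 2 * ‖x‖ ^ 2 + 1 ≤ Real.exp (a / 2 * ‖x‖ ^ 2) := Real.add_one_le_exp _
    have h3 : ‖x‖ ≤ 1 / (2 * a) + a / 2 * ‖x‖ ^ 2 := by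
      have : 0 ≤ (1 - a * ‖x‖) ^ 2 / (2 * a) := by positivity
      have h4 : (1 - a * ‖x‖) ^ 2 / (2 * a) = 1 / (2 * a) + a / 2 * ‖x‖ ^ 2 - ‖x‖ := by
        field_simp; ring
      linarith
    have h5 : 0 ≤ 1 / (2 * a) * (a / 2 * ‖x‖ ^ 2) := by positivity
    calc 1 + ‖x‖ ≤ (1 + 1 / (2 * a)) * (a / 2 * ‖x‖ ^ 2 + 1) := by linarith
      _ ≤ _ := by gcongr
  calc (1 + ‖x‖) * Real.exp (-a * ‖x‖ ^ 2)
      ≤ (1 + 1 / (2 * a)) * Real.exp (a / 2 * ‖x‖ ^ 2) * Real.exp (-a * ‖x‖ ^ 2) := by gcongr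
    _ = (1 + 1 / (2 * a)) * Real.exp (-(a / 2) * ‖x‖ ^ 2) := by
        rw [mul_assoc, ← Real.exp_add]; ring_nf

open scoped MatrixOrder in
lemma exists_eq_transpose_mul_self {A : Matrix (Fin d) (Fin d) ℝ} (hA : A.PosSemidef) :
    ∃ B : Matrix (Fin d) (Fin d) ℝ, A = Bᵀ * B := by
  obtain ⟨B, hB⟩ := CStarAlgebra.nonneg_iff_eq_star_mul_self.1 hA.nonneg
  exact ⟨B, by rw [hB, Matrix.star_eq_conjTranspose, Matrix.conjTranspose_eq_transpose_of_trivial]⟩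

lemma integral_exp_neg_quadForm {A : Matrix (Fin d) (Fin d) ℝ} (hA : A.PosDef) :
    ∫ x : E d, Real.exp (-(1 / 2 * quadForm A x)) = Real.sqrt ((2 * Real.pi) ^ d * A⁻¹.det) := by
  obtain ⟨B, hB⟩ := exists_eq_transpose_mul_self hA.posSemidef
  have hdet : A.det = B.det ^ 2 := by rw [hB, Matrix.det_mul, Matrix.det_transpose, sq]
  have hB0 : B.det ≠ 0 := fun h => hA.det_pos.ne' (by rw [hdet, h]; ring)
  set f : E d →ₗ[ℝ] E d := Matrix.toLpLin 2 2 B with hf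
  have hfdet : LinearMap.det f = B.det := by simp [hf]
  have hq : ∀ x : E d, quadForm A x = ‖f x‖ ^ 2 := fun x => by
    rw [EuclideanSpace.real_norm_sq_eq]
    simp only [quadForm, hB, hf]
    rw [← Matrix.mulVec_mulVec, Matrix.dotProduct_mulVec, Matrix.vecMul_transpose]
    simp [dotProduct, sq]
  have hcov : ∫ x : E d, Real.exp (-(1 / 2) * ‖f x‖ ^ 2)
      = |B.det|⁻¹ * ∫ x : E d, Real.exp (-(1 / 2) * ‖x‖ ^ 2) := by
    have h1 := Measure.map_linearMap_addHaar_eq_smul_addHaar (volume : Measure (E d))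
      (f := f) (by rwa [hfdet])
    have hfm : Measurable f := f.continuous_of_finiteDimensional.measurable
    have h2 := integral_map (μ := (volume : Measure (E d))) hfm.aemeasurable
      (f := fun x : E d => Real.exp (-(1 / 2) * ‖x‖ ^ 2)) (by fun_prop)
    rw [← h2, h1, integral_smul_measure, hfdet, abs_inv, ENNReal.toReal_ofReal (by positivity),
      smul_eq_mul]
  simp only [hq, ← neg_mul]
  rw [hcov, GaussianFourier.integral_rexp_neg_mul_sq_norm (by norm_num), finrank_euclideanSpace,
    Fintype.card_fin, Matrix.det_nonsing_inv, Ring.inverse_eq_inv', hdet,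
    Real.sqrt_mul (by positivity), Real.sqrt_inv, Real.sqrt_sq_eq_abs, mul_comm]
  congr 1
  rw [Real.sqrt_eq_rpow, ← Real.rpow_natCast, ← Real.rpow_mul (by positivity)]
  congr 1
  · ring
  · ring

/-! ### The change of variables to the local coordinate -/

section LocalPoint

variable {n : ℕ} {F : Type*} [NormedAddCommGroup F]

lemma integrable_comp_localPoint (hn : n ≠ 0) (θstar Z : E d) {f : E d → F} (hf : Integrable f) :
    Integrable fun ϑ => f (localPoint n θstar Z ϑ) := by
  have : Real.sqrt n ≠ 0 := (Real.sqrt_pos.2 (by positivity)).ne'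
  exact (hf.comp_add_left (θstar + (n : ℝ)⁻¹ • Z)).comp_smul (inv_ne_zero this)

lemma integral_comp_localPoint [NormedSpace ℝ F] (n : ℕ) (θstar Z : E d) (f : E d → F) :
    ∫ ϑ, f (localPoint n θstar Z ϑ) = Real.sqrt n ^ d • ∫ θ, f θ := by
  have h := Measure.integral_comp_inv_smul_of_nonneg (volume : Measure (E d))
    (fun x => f (θstar + (n : ℝ)⁻¹ • Z + x)) (Real.sqrt_nonneg n)
  rw [finrank_euclideanSpace, Fintype.card_fin, integral_add_left_eq_self] at h
  exact h

/-- The local coordinate `√n (θ - θ⋆) - Z/√n` of `θ`. -/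
def localCoord (n : ℕ) (θstar Z θ : E d) : E d :=
  Real.sqrt n • (θ - θstar) - (Real.sqrt n)⁻¹ • Z

lemma localCoord_localPoint (hn : n ≠ 0) (θstar Z ϑ : E d) :
    localCoord n θstar Z (localPoint n θstar Z ϑ) = ϑ := by
  rw [localCoord, sqrt_smul_localPoint_sub hn, add_sub_cancel_left]

lemma localPoint_localCoord (hn : n ≠ 0) (θstar Z θ : E d) :
    localPoint n θstar Z (localCoord n θstar Z θ) = θ := by
  have : Real.sqrt n ≠ 0 := (Real.sqrt_pos.2 (by positivity)).ne'
  rw [← sub_left_inj (a := θstar), localPoint_sub, localCoord, add_sub_cancel, smul_smul,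
    inv_mul_cancel₀ this, one_smul]

lemma norm_localCoord_le (n : ℕ) (θstar Z θ : E d) :
    ‖localCoord n θstar Z θ‖ ≤
      Real.sqrt n * (‖θ‖ + ‖θstar‖) + ‖(Real.sqrt n)⁻¹ • Z‖ := by
  refine (norm_sub_le _ _).trans ?_
  rw [norm_smul, Real.norm_of_nonneg (Real.sqrt_nonneg _)]
  gcongr
  exact norm_sub_le _ _

end LocalPoint

/-! ### Weighted `L¹` convergence of the local kernels -/

section Kernel

variable {n : ℕ} {s : E d → E d} {v : E d → Matrix (Fin d) (Fin d) ℝ}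

lemma localKernel_nonneg (hπ : ∀ θ ∈ Θ, 0 ≤ π θ) (Z ϑ : E d) :
    0 ≤ localKernel Θ n s v π θstar Z ϑ :=
  Set.indicator_nonneg (fun _ hθ => kernel_nonneg hπ hθ) _

lemma LimitModel.integrable_localKernel (hL : LimitModel Θ ψ V π θstar) (hn : n ≠ 0)
    (ha : Admissible Θ π θstar n s v) (Z : E d) :
    Integrable (localKernel Θ n s v π θstar Z) :=
  integrable_comp_localPoint hn θstar Z
    ((integrable_indicator_iff hL.measurableSet).2 (hL.integrableOn_kernel ha))

lemma LimitModel.integrableOn_weighted_kernel (hL : LimitModel Θ ψ V π θstar)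
    (ha : Admissible Θ π θstar n s v) (Z : E d) :
    IntegrableOn (fun θ => (1 + ‖localCoord n θstar Z θ‖) * kernel n s v π θ) Θ := by
  have hc : Continuous fun θ : E d => 1 + ‖localCoord n θstar Z θ‖ := by
    unfold localCoord; fun_prop
  have hdom : IntegrableOn (fun θ => (1 + Real.sqrt n * ‖θstar‖ + ‖(Real.sqrt n)⁻¹ • Z‖) * π θ
      + Real.sqrt n * (‖θ‖ * π θ)) Θ :=
    (hL.prior_integrable.const_mul _).add (hL.prior_moment.const_mul _)
  refine hdom.mono' (hc.aestronglyMeasurable.mul ha.aestronglyMeasurable) ?_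
  refine (ae_restrict_iff' hL.measurableSet).2 (ae_of_all _ fun θ hθ => ?_)
  have h0 := kernel_nonneg (n := n) (s := s) (v := v) hL.prior_nonneg hθ
  rw [Real.norm_of_nonneg (by positivity)]
  calc _ ≤ (1 + (Real.sqrt n * (‖θ‖ + ‖θstar‖) + ‖(Real.sqrt n)⁻¹ • Z‖)) * π θ := by
        gcongr
        · exact norm_localCoord_le _ _ _ _
        · exact kernel_le_prior hL.prior_nonneg ha.posSemidef hθ
    _ = _ := by ring

lemma LimitModel.integrable_weighted_localKernel (hL : LimitModel Θ ψ V π θstar) (hn : n ≠ 0)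
    (ha : Admissible Θ π θstar n s v) (Z : E d) :
    Integrable fun ϑ => (1 + ‖ϑ‖) * localKernel Θ n s v π θstar Z ϑ := by
  have h := integrable_comp_localPoint hn θstar Z
    ((integrable_indicator_iff hL.measurableSet).2 (hL.integrableOn_weighted_kernel ha Z))
  refine h.congr (ae_of_all _ fun ϑ => ?_)
  by_cases hm : localPoint n θstar Z ϑ ∈ Θ
  · simp [localKernel, hm, localCoord_localPoint hn]
  · simp [localKernel, hm]

end Kernel

lemma limitKernel_nonneg (hL : LimitModel Θ ψ V π θstar) (ϑ : E d) :
    0 ≤ limitKernel ψ V π θstar ϑ :=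
  mul_nonneg (Real.exp_nonneg _) hL.prior_pos.le

lemma continuous_limitKernel : Continuous (limitKernel ψ V π θstar) := by
  unfold limitKernel
  have h : Continuous fun x : E d => quadForm (OmegaStar ψ V θstar) x :=
    continuous_quadForm.comp (continuous_const.prodMk continuous_id)
  fun_prop

lemma LimitModel.integrable_weighted_limitKernel (hL : LimitModel Θ ψ V π θstar) :
    Integrable fun ϑ : E d => (1 + ‖ϑ‖) * limitKernel ψ V π θstar ϑ := by
  obtain ⟨c, hc, hq⟩ := exists_mul_norm_sq_le_quadForm
    (posDef_OmegaStar hL.posDef_star hL.invertible)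
  refine ((integrable_one_add_norm_mul_exp_neg (d := d) (a := c / 2)
    (by positivity)).mul_const (π θstar)).mono' ?_ (ae_of_all _ fun x => ?_)
  · exact ((continuous_const.add continuous_norm).mul continuous_limitKernel).aestronglyMeasurable
  · have hπ := hL.prior_pos
    have := limitKernel_nonneg hL x
    rw [Real.norm_of_nonneg (by positivity), limitKernel, ← mul_assoc]
    gcongr
    linarith [hq x]

lemma LimitModel.integrable_limitKernel (hL : LimitModel Θ ψ V π θstar) :
    Integrable (limitKernel ψ V π θstar) := by
  refine hL.integrable_weighted_limitKernel.mono' continuous_limitKernel.aestronglyMeasurable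
    (ae_of_all _ fun x => ?_)
  have := limitKernel_nonneg hL x
  rw [Real.norm_of_nonneg this]
  nlinarith [norm_nonneg x]

section Sequence

variable {n : ℕ → ℕ} {s : ℕ → E d → E d} {v : ℕ → E d → Matrix (Fin d) (Fin d) ℝ}

/-- The contribution of parameters away from `θ⋆` to the weighted local kernel vanishes: the
exponential decay of the kernel beats the Jacobian `n^{d/2}` and the weight. -/
lemma TypicalSeq.tendsto_integral_far (hS : TypicalSeq Θ ψ V π θstar n s v)
    (hL : LimitModel Θ ψ V π θstar) {δ : ℝ} (hδ : 0 < δ) :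
    Tendsto (fun k => ∫ ϑ, {ϑ | δ ≤ ‖localPoint (n k) θstar
        (recentring ψ V θstar (s k θstar)) ϑ - θstar‖}.indicator
        (fun ϑ => (1 + ‖ϑ‖) * localKernel Θ (n k) (s k) (v k) π θstar
          (recentring ψ V θstar (s k θstar)) ϑ) ϑ) atTop (𝓝 0) := by
  obtain ⟨c, hc, hfar⟩ := hS.exists_far_bound hL hδ
  obtain ⟨M, hM0, hM⟩ := hS.exists_recentring_bound
  set I := ∫ θ in Θ, π θ with hI
  set J := ∫ θ in Θ, ‖θ‖ * π θ with hJ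
  have hI0 : 0 ≤ I := setIntegral_nonneg hL.measurableSet hL.prior_nonneg
  have hJ0 : 0 ≤ J := setIntegral_nonneg hL.measurableSet
    fun θ hθ => mul_nonneg (norm_nonneg _) (hL.prior_nonneg θ hθ)
  have hdecay : Tendsto (fun k => ((1 + ‖θstar‖ + M) * I + J) *
      ((n k : ℝ) ^ (d + 1) * Real.exp (-c) ^ (n k))) atTop (𝓝 0) := by
    have h1 : |Real.exp (-c)| < 1 := by
      rw [abs_of_pos (Real.exp_pos _), Real.exp_lt_one_iff]; linarith
    simpa using ((tendsto_pow_const_mul_const_pow_of_abs_lt_one (d + 1) h1).comp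
      hS.tendsto_size).const_mul ((1 + ‖θstar‖ + M) * I + J)
  refine squeeze_zero' (Eventually.of_forall fun k => ?_) ?_ hdecay
  · refine integral_nonneg fun ϑ => Set.indicator_nonneg (fun ϑ _ => ?_) _
    exact mul_nonneg (by positivity) (localKernel_nonneg hL.prior_nonneg _ _)
  filter_upwards [hfar, hS.eventually_ne_zero] with k hk hn
  set Z := recentring ψ V θstar (s k θstar) with hZ
  have hn1 : (1 : ℝ) ≤ n k := by exact_mod_cast Nat.one_le_iff_ne_zero.2 hn
  have hr1 : 1 ≤ Real.sqrt (n k) := Real.one_le_sqrt.2 hn1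
  have hrn : Real.sqrt (n k) ≤ n k := by
    rw [Real.sqrt_le_left (by positivity)]; nlinarith
  have hfarset : MeasurableSet {θ : E d | δ ≤ ‖θ - θstar‖} :=
    (isClosed_le continuous_const (by fun_prop)).measurableSet
  have hcov : ∫ ϑ, {ϑ | δ ≤ ‖localPoint (n k) θstar Z ϑ - θstar‖}.indicator
        (fun ϑ => (1 + ‖ϑ‖) * localKernel Θ (n k) (s k) (v k) π θstar Z ϑ) ϑ
      = Real.sqrt (n k) ^ d * ∫ θ in Θ, {θ | δ ≤ ‖θ - θstar‖}.indicator
        (fun θ => (1 + ‖localCoord (n k) θstar Z θ‖) * kernel (n k) (s k) (v k) π θ) θ := by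
    rw [← integral_indicator hL.measurableSet, ← smul_eq_mul, ← integral_comp_localPoint _ θstar Z]
    refine integral_congr_ae (ae_of_all _ fun ϑ => ?_)
    by_cases h1 : δ ≤ ‖localPoint (n k) θstar Z ϑ - θstar‖ <;>
      by_cases h2 : localPoint (n k) θstar Z ϑ ∈ Θ <;>
      simp [Set.indicator, localKernel, h1, h2, localCoord_localPoint hn]
  have hbound : ∫ θ in Θ, {θ | δ ≤ ‖θ - θstar‖}.indicator
        (fun θ => (1 + ‖localCoord (n k) θstar Z θ‖) * kernel (n k) (s k) (v k) π θ) θ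
      ≤ ∫ θ in Θ, Real.exp (-c * n k) * (Real.sqrt (n k) * ((1 + ‖θstar‖ + M) * π θ
          + ‖θ‖ * π θ)) := by
    refine integral_mono_ae ((hL.integrableOn_weighted_kernel (hS.admissible k) Z).indicator
      hfarset) ((((hL.prior_integrable.const_mul _).add hL.prior_moment).const_mul _).const_mul _) ?_
    filter_upwards [hk, ae_restrict_mem hL.measurableSet] with θ h1 hθ
    have hπ := hL.prior_nonneg θ hθ
    by_cases h2 : δ ≤ ‖θ - θstar‖
    · rw [Set.indicator_of_mem (by exact h2)]
      have h3 : 1 + ‖localCoord (n k) θstar Z θ‖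
          ≤ Real.sqrt (n k) * (1 + ‖θstar‖ + M + ‖θ‖) := by
        have := norm_localCoord_le (n k) θstar Z θ
        have h4 := hM k
        nlinarith
      calc _ ≤ Real.sqrt (n k) * (1 + ‖θstar‖ + M + ‖θ‖) * (Real.exp (-c * n k) * π θ) := by
            gcongr
            · exact kernel_nonneg hL.prior_nonneg hθ
            · exact h1 h2
        _ = _ := by ring
    · rw [Set.indicator_of_notMem (by exact h2)]
      positivity
  have hval : ∫ θ in Θ, Real.exp (-c * n k) * (Real.sqrt (n k) * ((1 + ‖θstar‖ + M) * π θ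
          + ‖θ‖ * π θ))
      = Real.exp (-c * n k) * (Real.sqrt (n k) * ((1 + ‖θstar‖ + M) * I + J)) := by
    rw [integral_const_mul, integral_const_mul,
      integral_add (hL.prior_integrable.const_mul _) hL.prior_moment, integral_const_mul]
  rw [hcov]
  calc _ ≤ Real.sqrt (n k) ^ d *
        (Real.exp (-c * n k) * (Real.sqrt (n k) * ((1 + ‖θstar‖ + M) * I + J))) := by
        rw [← hval]; gcongr
    _ = ((1 + ‖θstar‖ + M) * I + J) * (Real.sqrt (n k) ^ (d + 1) * Real.exp (-c) ^ (n k)) := by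
        rw [← Real.exp_nat_mul, mul_comm (n k : ℝ) (-c)]; ring
    _ ≤ _ := by gcongr

/-- Weighted `L¹` convergence of the unnormalised local posteriors. -/
lemma TypicalSeq.tendsto_integral_localKernel_sub (hS : TypicalSeq Θ ψ V π θstar n s v)
    (hL : LimitModel Θ ψ V π θstar) :
    Tendsto (fun k => ∫ ϑ, (1 + ‖ϑ‖) * |localKernel Θ (n k) (s k) (v k) π θstar
        (recentring ψ V θstar (s k θstar)) ϑ - limitKernel ψ V π θstar ϑ|) atTop (𝓝 0) := by
  obtain ⟨δ, C, a, hδ, hC, ha, hgauss⟩ := hS.exists_gaussian_bound hL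
  set p : ℕ → E d → E d := fun k => localPoint (n k) θstar (recentring ψ V θstar (s k θstar))
    with hp
  set H : ℕ → E d → ℝ := fun k => localKernel Θ (n k) (s k) (v k) π θstar
    (recentring ψ V θstar (s k θstar)) with hH
  set g := limitKernel ψ V π θstar with hg
  set D : ℕ → Set (E d) := fun k => {ϑ | δ ≤ ‖p k ϑ - θstar‖} with hD
  have hpc : ∀ k, Continuous (p k) := fun k => by
    simp only [hp]; unfold localPoint; fun_prop
  have hDm : ∀ k, MeasurableSet (D k) := fun k =>
    (isClosed_le continuous_const (((hpc k).sub continuous_const).norm)).measurableSet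
  have hHi : ∀ᶠ k in atTop, Integrable (H k) := by
    filter_upwards [hS.eventually_ne_zero] with k hn
    exact hL.integrable_localKernel hn (hS.admissible k) _
  have hH0 : ∀ k ϑ, 0 ≤ H k ϑ := fun k ϑ => localKernel_nonneg hL.prior_nonneg _ _
  have hg0 : ∀ ϑ, 0 ≤ g ϑ := limitKernel_nonneg hL
  -- near `θ⋆` dominated convergence applies
  set bound : E d → ℝ := fun ϑ => C * ((1 + ‖ϑ‖) * Real.exp (-a * ‖ϑ‖ ^ 2)) + (1 + ‖ϑ‖) * g ϑ
    with hbd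
  have hbound : Integrable bound :=
    ((integrable_one_add_norm_mul_exp_neg ha).const_mul C).add hL.integrable_weighted_limitKernel
  have hnearm : ∀ᶠ k in atTop, AEStronglyMeasurable
      (fun ϑ => (1 + ‖ϑ‖) * |(D k)ᶜ.indicator (H k) ϑ - g ϑ|) volume := by
    filter_upwards [hHi] with k hk
    have hc : Continuous fun ϑ : E d => 1 + ‖ϑ‖ := by fun_prop
    have hgm : AEStronglyMeasurable g volume := continuous_limitKernel.aestronglyMeasurable
    exact hc.aestronglyMeasurable.mul
      ((hk.aestronglyMeasurable.indicator (hDm k).compl).sub hgm).norm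
  have hnearb : ∀ᶠ k in atTop, ∀ᵐ ϑ ∂volume,
      ‖(1 + ‖ϑ‖) * |(D k)ᶜ.indicator (H k) ϑ - g ϑ|‖ ≤ bound ϑ := by
    filter_upwards [hgauss] with k hk
    refine ae_of_all _ fun ϑ => ?_
    rw [Real.norm_of_nonneg (by positivity), hbd]
    have h1 : 0 ≤ (D k)ᶜ.indicator (H k) ϑ := Set.indicator_nonneg (fun ϑ _ => hH0 k ϑ) _
    have h2 : (D k)ᶜ.indicator (H k) ϑ ≤ C * Real.exp (-a * ‖ϑ‖ ^ 2) := by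
      by_cases hm : ϑ ∈ (D k)ᶜ
      · rw [Set.indicator_of_mem hm]
        exact hk ϑ (not_le.1 hm)
      · rw [Set.indicator_of_notMem hm]
        positivity
    have h3 : |(D k)ᶜ.indicator (H k) ϑ - g ϑ| ≤ C * Real.exp (-a * ‖ϑ‖ ^ 2) + g ϑ := by
      rw [abs_le]; constructor <;> linarith [hg0 ϑ]
    calc _ ≤ (1 + ‖ϑ‖) * (C * Real.exp (-a * ‖ϑ‖ ^ 2) + g ϑ) := by gcongr
      _ = _ := by ring
  have hnearl : ∀ᵐ ϑ ∂volume, Tendsto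
      (fun k => (1 + ‖ϑ‖) * |(D k)ᶜ.indicator (H k) ϑ - g ϑ|) atTop (𝓝 0) := by
    refine ae_of_all _ fun ϑ => ?_
    have h1 : Tendsto (fun k => (1 + ‖ϑ‖) * |H k ϑ - g ϑ|) atTop (𝓝 0) := by
      simpa [hg, hH] using ((hS.tendsto_localKernel hL ϑ).sub_const (g ϑ)).abs.const_mul (1 + ‖ϑ‖)
    refine h1.congr' ?_
    filter_upwards [(hS.tendsto_localPoint (ψ := ψ) (V := V) ϑ).eventually
      (Metric.ball_mem_nhds θstar hδ)] with k hk
    rw [Set.indicator_of_mem]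
    exact not_le.2 (by simpa [dist_eq_norm] using hk)
  have hnear := tendsto_integral_filter_of_dominated_convergence bound hnearm hnearb hbound hnearl
  rw [integral_zero] at hnear
  have hsum := hnear.add (hS.tendsto_integral_far hL hδ)
  rw [add_zero] at hsum
  refine squeeze_zero' (Eventually.of_forall fun k => integral_nonneg fun ϑ => by positivity) ?_ hsum
  filter_upwards [hnearm, hnearb, hS.eventually_ne_zero] with k h1 h2 hn
  have hi1 : Integrable fun ϑ => (1 + ‖ϑ‖) * |(D k)ᶜ.indicator (H k) ϑ - g ϑ| :=
    hbound.mono' h1 h2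
  have hi2 : Integrable ((D k).indicator fun ϑ => (1 + ‖ϑ‖) * H k ϑ) :=
    (hL.integrable_weighted_localKernel hn (hS.admissible k) _).indicator (hDm k)
  rw [← integral_add hi1 hi2]
  refine integral_mono_of_nonneg (ae_of_all _ fun ϑ => by positivity) (hi1.add hi2)
    (ae_of_all _ fun ϑ => ?_)
  by_cases hm : ϑ ∈ D k
  · have hm' : ϑ ∉ (D k)ᶜ := fun h => h hm
    simp only [Set.indicator_of_mem hm, Set.indicator_of_notMem hm']
    have h3 : |H k ϑ - g ϑ| ≤ |0 - g ϑ| + H k ϑ := by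
      rw [zero_sub, abs_neg, abs_of_nonneg (hg0 ϑ), abs_le]
      constructor <;> linarith [hg0 ϑ, hH0 k ϑ]
    calc _ ≤ (1 + ‖ϑ‖) * (|0 - g ϑ| + H k ϑ) := by gcongr
      _ = _ := by ring
  · have hm' : ϑ ∈ (D k)ᶜ := hm
    simp only [Set.indicator_of_notMem hm, Set.indicator_of_mem hm', add_zero]
    exact le_rfl

end Sequence

/-! ### Normalisation -/

/-- Weighted `L¹` convergence is inherited by the normalised functions. -/
lemma tendsto_integral_div_sub_div {H : ℕ → E d → ℝ} {g : E d → ℝ}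
    (hH : ∀ᶠ k in atTop, Integrable (H k))
    (hwH : ∀ᶠ k in atTop, Integrable fun x => (1 + ‖x‖) * H k x)
    (hg : Integrable g) (hwg : Integrable fun x => (1 + ‖x‖) * g x)
    (hg0 : ∀ x, 0 ≤ g x) (hpos : 0 < ∫ x, g x)
    (h : Tendsto (fun k => ∫ x, (1 + ‖x‖) * |H k x - g x|) atTop (𝓝 0)) :
    Tendsto (fun k => ∫ x, (1 + ‖x‖) * |H k x / (∫ y, H k y) - g x / (∫ y, g y)|)
      atTop (𝓝 0) := by
  set D := ∫ x, g x with hD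
  have hwsub : ∀ᶠ k in atTop, Integrable fun x => (1 + ‖x‖) * |H k x - g x| := by
    filter_upwards [hwH] with k hk
    refine (hk.sub hwg).abs.congr (ae_of_all _ fun x => ?_)
    have h0 : 0 ≤ 1 + ‖x‖ := by positivity
    simp only [Pi.sub_apply]
    rw [← mul_sub, abs_mul, abs_of_nonneg h0]
  have hc : Tendsto (fun k => ∫ x, H k x) atTop (𝓝 D) := by
    rw [tendsto_iff_norm_sub_tendsto_zero]
    refine squeeze_zero' (Eventually.of_forall fun k => norm_nonneg _) ?_ h
    filter_upwards [hH, hwsub] with k hk hk2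
    rw [hD, ← integral_sub hk hg]
    refine (norm_integral_le_integral_norm _).trans
      (integral_mono_of_nonneg (ae_of_all _ fun x => norm_nonneg _) hk2 (ae_of_all _ fun x => ?_))
    change |H k x - g x| ≤ (1 + ‖x‖) * |H k x - g x|
    nlinarith [mul_nonneg (norm_nonneg x) (abs_nonneg (H k x - g x))]
  have hcinv : Tendsto (fun k => (∫ x, H k x)⁻¹) atTop (𝓝 D⁻¹) := hc.inv₀ hpos.ne'
  have hlim : Tendsto (fun k => (∫ x, H k x)⁻¹ * (∫ x, (1 + ‖x‖) * |H k x - g x|)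
      + |(∫ x, H k x)⁻¹ - D⁻¹| * ∫ x, (1 + ‖x‖) * g x) atTop (𝓝 0) := by
    simpa using (hcinv.mul h).add
      (((hcinv.sub_const D⁻¹).abs).mul_const (∫ x, (1 + ‖x‖) * g x))
  refine squeeze_zero' (Eventually.of_forall fun k => integral_nonneg fun x => by positivity) ?_ hlim
  filter_upwards [hwsub, hc.eventually_const_lt hpos] with k hk hck
  rw [← integral_const_mul, ← integral_const_mul,
    ← integral_add (hk.const_mul _) (hwg.const_mul _)]
  refine integral_mono_of_nonneg (ae_of_all _ fun x => by positivity)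
    ((hk.const_mul _).add (hwg.const_mul _)) (ae_of_all _ fun x => ?_)
  set c := ∫ x, H k x with hc'
  have h1 : H k x / c - g x / D = c⁻¹ * (H k x - g x) + (c⁻¹ - D⁻¹) * g x := by
    rw [div_eq_mul_inv, div_eq_mul_inv]; ring
  have h2 : |H k x / c - g x / D| ≤ c⁻¹ * |H k x - g x| + |c⁻¹ - D⁻¹| * g x := by
    rw [h1]
    refine (abs_add_le _ _).trans_eq ?_
    rw [abs_mul, abs_mul, abs_of_pos (inv_pos.2 hck), abs_of_nonneg (hg0 x)]
  calc _ ≤ (1 + ‖x‖) * (c⁻¹ * |H k x - g x| + |c⁻¹ - D⁻¹| * g x) :=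
        mul_le_mul_of_nonneg_left h2 (by positivity)
    _ = _ := by ring

lemma LimitModel.integral_limitKernel (hL : LimitModel Θ ψ V π θstar) :
    ∫ ϑ, limitKernel ψ V π θstar ϑ =
      Real.sqrt ((2 * Real.pi) ^ d * (OmegaStar ψ V θstar)⁻¹.det) * π θstar := by
  simp only [limitKernel]
  rw [integral_mul_const,
    integral_exp_neg_quadForm (posDef_OmegaStar hL.posDef_star hL.invertible)]

lemma LimitModel.integral_limitKernel_pos (hL : LimitModel Θ ψ V π θstar) :
    0 < ∫ ϑ, limitKernel ψ V π θstar ϑ := by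
  rw [hL.integral_limitKernel]
  have h := (posDef_OmegaStar hL.posDef_star hL.invertible).inv.det_pos
  have := hL.prior_pos
  positivity

lemma LimitModel.limitKernel_div_integral (hL : LimitModel Θ ψ V π θstar) (ϑ : E d) :
    limitKernel ψ V π θstar ϑ / (∫ y, limitKernel ψ V π θstar y)
      = gaussianDensity (OmegaStar ψ V θstar)⁻¹ ϑ := by
  have hΩ := posDef_OmegaStar hL.posDef_star hL.invertible
  have hπ := hL.prior_pos.ne'
  rw [hL.integral_limitKernel, limitKernel, gaussianDensity,
    Matrix.nonsing_inv_nonsing_inv _ ((Matrix.isUnit_iff_isUnit_det _).1 hΩ.isUnit),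
    mul_div_mul_right _ _ hπ, div_eq_inv_mul, neg_mul]

/-- The centred Gaussian density has mean zero. -/
lemma integral_gaussianDensity_smul (S : Matrix (Fin d) (Fin d) ℝ) :
    ∫ ϑ : E d, gaussianDensity S ϑ • ϑ = 0 := by
  have h := integral_neg_eq_self (fun ϑ : E d => gaussianDensity S ϑ • ϑ) volume
  have h1 : ∀ ϑ : E d, gaussianDensity S (-ϑ) • (-ϑ) = -(gaussianDensity S ϑ • ϑ) := fun ϑ => by
    simp [gaussianDensity, quadForm, Matrix.mulVec_neg]
  simp only [h1, integral_neg] at h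
  have h2 : (2 : ℝ) • ∫ ϑ : E d, gaussianDensity S ϑ • ϑ = 0 := by
    rw [two_smul]
    nth_rewrite 1 [← h]
    exact neg_add_cancel _
  exact (smul_eq_zero.1 h2).resolve_left two_ne_zero

section Kernel

variable {n : ℕ} {s : E d → E d} {v : E d → Matrix (Fin d) (Fin d) ℝ}

lemma LimitModel.integral_localKernel (hL : LimitModel Θ ψ V π θstar) (n : ℕ) (s : E d → E d)
    (v : E d → Matrix (Fin d) (Fin d) ℝ) (Z : E d) :
    ∫ ϑ, localKernel Θ n s v π θstar Z ϑ = Real.sqrt n ^ d * ∫ θ in Θ, kernel n s v π θ := by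
  simp only [localKernel]
  rw [integral_comp_localPoint, integral_indicator hL.measurableSet, smul_eq_mul]

lemma LimitModel.localPosterior_eq (hL : LimitModel Θ ψ V π θstar) (n : ℕ) (s : E d → E d)
    (v : E d → Matrix (Fin d) (Fin d) ℝ) (Z : E d) {ϑ : E d}
    (hϑ : localPoint n θstar Z ϑ ∈ Θ) :
    localPosterior Θ n s v π θstar Z ϑ =
      localKernel Θ n s v π θstar Z ϑ / ∫ y, localKernel Θ n s v π θstar Z y := by
  rw [hL.integral_localKernel, localKernel, Set.indicator_of_mem hϑ, localPosterior, posterior,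
    ← localPoint, div_eq_mul_inv, div_eq_mul_inv, mul_inv]
  ring

lemma mem_localSpace_iff (hn : n ≠ 0) (Z ϑ : E d) :
    ϑ ∈ localSpace Θ n θstar Z ↔ localPoint n θstar Z ϑ ∈ Θ := by
  constructor
  · rintro ⟨θ, hθ, rfl⟩
    change localPoint n θstar Z (localCoord n θstar Z θ) ∈ Θ
    rwa [localPoint_localCoord hn]
  · exact fun h => ⟨_, h, localCoord_localPoint hn θstar Z ϑ⟩

lemma measurableSet_localSpace (hΘ : MeasurableSet Θ) (hn : n ≠ 0) (Z : E d) :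
    MeasurableSet (localSpace Θ n θstar Z) := by
  have h : localSpace Θ n θstar Z = localPoint n θstar Z ⁻¹' Θ := by
    ext ϑ; exact mem_localSpace_iff hn Z ϑ
  have hc : Continuous (localPoint n θstar Z) := by unfold localPoint; fun_prop
  rw [h]
  exact hc.measurable hΘ

lemma LimitModel.integrable_weighted_abs_sub (hL : LimitModel Θ ψ V π θstar) (hn : n ≠ 0)
    (ha : Admissible Θ π θstar n s v) (Z : E d) :
    Integrable fun ϑ => (1 + ‖ϑ‖) * |localKernel Θ n s v π θstar Z ϑ /
      (∫ y, localKernel Θ n s v π θstar Z y) - gaussianDensity (OmegaStar ψ V θstar)⁻¹ ϑ| := by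
  have h1 := (hL.integrable_weighted_localKernel hn ha Z).div_const
    (∫ y, localKernel Θ n s v π θstar Z y)
  have h2 := hL.integrable_weighted_limitKernel.div_const (∫ y, limitKernel ψ V π θstar y)
  refine (h1.sub h2).abs.congr (ae_of_all _ fun ϑ => ?_)
  have h0 : 0 ≤ 1 + ‖ϑ‖ := by positivity
  simp only [Pi.sub_apply]
  rw [← hL.limitKernel_div_integral, mul_div_assoc, mul_div_assoc, ← mul_sub, abs_mul,
    abs_of_nonneg h0]

lemma LimitModel.lintegral_localPosterior_sub_le (hL : LimitModel Θ ψ V π θstar) (hn : n ≠ 0)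
    (ha : Admissible Θ π θstar n s v) (Z : E d) :
    ∫⁻ ϑ in localSpace Θ n θstar Z, ENNReal.ofReal (‖ϑ‖ *
        |localPosterior Θ n s v π θstar Z ϑ - gaussianDensity (OmegaStar ψ V θstar)⁻¹ ϑ|)
      ≤ ENNReal.ofReal (∫ ϑ, (1 + ‖ϑ‖) * |localKernel Θ n s v π θstar Z ϑ /
        (∫ y, localKernel Θ n s v π θstar Z y) - gaussianDensity (OmegaStar ψ V θstar)⁻¹ ϑ|) := by
  rw [ofReal_integral_eq_lintegral_ofReal (hL.integrable_weighted_abs_sub hn ha Z)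
    (ae_of_all _ fun ϑ => by positivity)]
  refine (setLIntegral_mono' (measurableSet_localSpace hL.measurableSet hn Z) fun ϑ hϑ => ?_).trans
    (setLIntegral_le_lintegral _ _)
  rw [hL.localPosterior_eq n s v Z ((mem_localSpace_iff hn Z ϑ).1 hϑ)]
  gcongr
  linarith

/-- In the local coordinate, the posterior mean is the mean of the normalised local kernel. -/
lemma LimitModel.integral_localKernel_div_smul (hL : LimitModel Θ ψ V π θstar) (hn : n ≠ 0)
    (ha : Admissible Θ π θstar n s v) (Z : E d) :
    ∫ ϑ, (localKernel Θ n s v π θstar Z ϑ / ∫ y, localKernel Θ n s v π θstar Z y) • ϑ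
      = Real.sqrt n • (posteriorMean Θ n s v π - θstar) - (Real.sqrt n)⁻¹ • Z := by
  set K := ∫ θ in Θ, kernel n s v π θ with hK
  have hK0 : K ≠ 0 := (hL.integral_kernel_pos ha).ne'
  have hr0 : 0 < Real.sqrt n := Real.sqrt_pos.2 (by positivity)
  have h1 : ∀ ϑ, (localKernel Θ n s v π θstar Z ϑ / ∫ y, localKernel Θ n s v π θstar Z y) • ϑ
      = (fun θ => Θ.indicator (fun θ => ((Real.sqrt n ^ d)⁻¹ * posterior Θ n s v π θ) •
          localCoord n θstar Z θ) θ) (localPoint n θstar Z ϑ) := fun ϑ => by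
    by_cases hm : localPoint n θstar Z ϑ ∈ Θ
    · simp only [Set.indicator_of_mem hm, localCoord_localPoint hn]
      rw [← hL.localPosterior_eq n s v Z hm, localPosterior, ← localPoint]
    · simp [localKernel, hm]
  have hpost : IntegrableOn (posterior Θ n s v π) Θ := (hL.integrableOn_kernel ha).div_const _
  have hpost1 : ∫ θ in Θ, posterior Θ n s v π θ = 1 := by
    simp only [posterior]
    rw [integral_div, div_self hK0]
  have h2 : ∀ θ, posterior Θ n s v π θ • localCoord n θstar Z θ
      = Real.sqrt n • (posterior Θ n s v π θ • θ)
        - posterior Θ n s v π θ • (Real.sqrt n • θstar + (Real.sqrt n)⁻¹ • Z) := fun θ => by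
    rw [localCoord]
    module
  simp_rw [h1]
  rw [integral_comp_localPoint, integral_indicator hL.measurableSet]
  simp_rw [mul_smul]
  rw [integral_smul, smul_smul, mul_inv_cancel₀ (by positivity), one_smul]
  simp_rw [h2]
  have h3 : IntegrableOn (fun θ => Real.sqrt n • (posterior Θ n s v π θ • θ)) Θ :=
    Integrable.fun_smul (Real.sqrt n) (hL.integrableOn_posterior_smul ha)
  rw [integral_sub h3 (hpost.smul_const _),
    integral_smul, integral_smul_const, hpost1, one_smul, ← posteriorMean, smul_sub]
  abel

lemma norm_smul_le_norm_weighted (t : ℝ) (x : E d) : ‖t • x‖ ≤ ‖(1 + ‖x‖) * t‖ := by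
  rw [norm_smul, norm_mul, Real.norm_of_nonneg (by positivity : (0 : ℝ) ≤ 1 + ‖x‖)]
  nlinarith [norm_nonneg t]

lemma LimitModel.norm_posteriorMean_sub_le (hL : LimitModel Θ ψ V π θstar) (hn : n ≠ 0)
    (ha : Admissible Θ π θstar n s v) (Z : E d) :
    ‖Real.sqrt n • (posteriorMean Θ n s v π - θstar) - (Real.sqrt n)⁻¹ • Z‖
      ≤ ∫ ϑ, (1 + ‖ϑ‖) * |localKernel Θ n s v π θstar Z ϑ /
        (∫ y, localKernel Θ n s v π θstar Z y) - gaussianDensity (OmegaStar ψ V θstar)⁻¹ ϑ| := by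
  set N := gaussianDensity (OmegaStar ψ V θstar)⁻¹ with hN
  set c := ∫ y, localKernel Θ n s v π θstar Z y with hc
  have hi1 : Integrable fun ϑ => (localKernel Θ n s v π θstar Z ϑ / c) • ϑ := by
    refine ((hL.integrable_weighted_localKernel hn ha Z).div_const c).mono
      (((hL.integrable_localKernel hn ha Z).div_const c).aestronglyMeasurable.smul
        aestronglyMeasurable_id) (ae_of_all _ fun ϑ => ?_)
    rw [mul_div_assoc]
    exact norm_smul_le_norm_weighted _ _
  have hi2 : Integrable fun ϑ => N ϑ • ϑ := by
    have hNc : Continuous N := by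
      have := (continuous_limitKernel (ψ := ψ) (V := V) (π := π) (θstar := θstar)).div_const
        (∫ y, limitKernel ψ V π θstar y)
      simpa only [hL.limitKernel_div_integral] using this
    refine (hL.integrable_weighted_limitKernel.div_const (∫ y, limitKernel ψ V π θstar y)).mono
      (hNc.smul continuous_id).aestronglyMeasurable (ae_of_all _ fun ϑ => ?_)
    rw [mul_div_assoc, hL.limitKernel_div_integral]
    exact norm_smul_le_norm_weighted _ _
  rw [← hL.integral_localKernel_div_smul hn ha Z,
    ← sub_zero (∫ ϑ, _ • ϑ), ← integral_gaussianDensity_smul (OmegaStar ψ V θstar)⁻¹,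
    ← integral_sub hi1 hi2]
  refine (norm_integral_le_integral_norm _).trans (integral_mono_of_nonneg
    (ae_of_all _ fun _ => norm_nonneg _) (hL.integrable_weighted_abs_sub hn ha Z)
    (ae_of_all _ fun ϑ => ?_))
  simp only [← sub_smul, norm_smul, Real.norm_eq_abs]
  rw [mul_comm]
  gcongr
  linarith

end Kernel

section Sequence

variable {n : ℕ → ℕ} {s : ℕ → E d → E d} {v : ℕ → E d → Matrix (Fin d) (Fin d) ℝ}

lemma TypicalSeq.tendsto_integral_normalised (hS : TypicalSeq Θ ψ V π θstar n s v)
    (hL : LimitModel Θ ψ V π θstar) :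
    Tendsto (fun k => ∫ ϑ, (1 + ‖ϑ‖) *
      |localKernel Θ (n k) (s k) (v k) π θstar (recentring ψ V θstar (s k θstar)) ϑ /
        (∫ y, localKernel Θ (n k) (s k) (v k) π θstar (recentring ψ V θstar (s k θstar)) y) -
        gaussianDensity (OmegaStar ψ V θstar)⁻¹ ϑ|) atTop (𝓝 0) := by
  simp only [← hL.limitKernel_div_integral]
  refine tendsto_integral_div_sub_div ?_ ?_ hL.integrable_limitKernel
    hL.integrable_weighted_limitKernel (limitKernel_nonneg hL) hL.integral_limitKernel_pos
    (hS.tendsto_integral_localKernel_sub hL)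
  · filter_upwards [hS.eventually_ne_zero] with k hn
    exact hL.integrable_localKernel hn (hS.admissible k) _
  · filter_upwards [hS.eventually_ne_zero] with k hn
    exact hL.integrable_weighted_localKernel hn (hS.admissible k) _

/-- Asymptotic normality of the posterior along a typical sequence of data points. -/
lemma TypicalSeq.tendsto_lintegral_localPosterior (hS : TypicalSeq Θ ψ V π θstar n s v)
    (hL : LimitModel Θ ψ V π θstar) :
    Tendsto (fun k => ∫⁻ ϑ in localSpace Θ (n k) θstar (recentring ψ V θstar (s k θstar)),
      ENNReal.ofReal (‖ϑ‖ * |localPosterior Θ (n k) (s k) (v k) π θstar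
        (recentring ψ V θstar (s k θstar)) ϑ - gaussianDensity (OmegaStar ψ V θstar)⁻¹ ϑ|))
      atTop (𝓝 0) := by
  have h := ENNReal.tendsto_ofReal (hS.tendsto_integral_normalised hL)
  rw [ENNReal.ofReal_zero] at h
  refine tendsto_of_tendsto_of_tendsto_of_le_of_le' tendsto_const_nhds h
    (Eventually.of_forall fun _ => zero_le) ?_
  filter_upwards [hS.eventually_ne_zero] with k hn
  exact hL.lintegral_localPosterior_sub_le hn (hS.admissible k) _

/-- Along a typical sequence the centred posterior mean is asymptotically `Zₙ/√n`. -/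
lemma TypicalSeq.tendsto_posteriorMean (hS : TypicalSeq Θ ψ V π θstar n s v)
    (hL : LimitModel Θ ψ V π θstar) :
    Tendsto (fun k => ‖Real.sqrt (n k) • (posteriorMean Θ (n k) (s k) (v k) π - θstar)
      - (Real.sqrt (n k))⁻¹ • recentring ψ V θstar (s k θstar)‖) atTop (𝓝 0) := by
  refine squeeze_zero' (Eventually.of_forall fun _ => norm_nonneg _) ?_
    (hS.tendsto_integral_normalised hL)
  filter_upwards [hS.eventually_ne_zero] with k hn
  exact hL.norm_posteriorMean_sub_le hn (hS.admissible k) _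

end Sequence

/-! ### Measurability -/

section Measurability

variable {α : Type*} [MeasurableSpace α]

lemma measurable_det {A : α → Matrix (Fin d) (Fin d) ℝ} (hA : ∀ i j, Measurable fun a => A a i j) :
    Measurable fun a => (A a).det := by
  simp only [Matrix.det_apply]
  exact Finset.measurable_sum _ fun σ _ =>
    (Finset.measurable_prod _ fun i _ => hA _ _).const_smul _

lemma measurable_inv_apply {A : α → Matrix (Fin d) (Fin d) ℝ}
    (hA : ∀ i j, Measurable fun a => A a i j) (i j : Fin d) :
    Measurable fun a => (A a)⁻¹ i j := by
  simp only [Matrix.inv_def, Ring.inverse_eq_inv', Matrix.smul_apply, smul_eq_mul,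
    Matrix.adjugate_apply]
  refine (measurable_det hA).inv.mul (measurable_det fun k l => ?_)
  by_cases h : k = j
  · subst h
    simp only [Matrix.updateRow_self]
    exact measurable_const
  · simp only [Matrix.updateRow_ne h]
    exact hA k l

lemma measurable_quadForm {A : α → Matrix (Fin d) (Fin d) ℝ} {x : α → E d}
    (hA : ∀ i j, Measurable fun a => A a i j) (hx : Measurable x) :
    Measurable fun a => quadForm (A a) (x a) := by
  have h : ∀ i, Measurable fun a => (x a).ofLp i := fun i => by fun_prop
  simp only [quadForm, Matrix.mulVec, dotProduct]
  exact Finset.measurable_sum _ fun i _ => (h i).mul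
    (Finset.measurable_sum _ fun j _ => (hA i j).mul (h j))

/-- The posterior kernel is jointly measurable in the data and the parameter `θ a`. -/
lemma measurable_kernel (n : ℕ) {ψn : α → E d → E d} {Vn : α → E d → Matrix (Fin d) (Fin d) ℝ}
    {π : E d → ℝ} {θ : α → E d} (hψ : Measurable fun a => ψn a (θ a))
    (hV : ∀ i j, Measurable fun a => Vn a (θ a) i j) (hπ : Measurable fun a => π (θ a)) :
    Measurable fun a => kernel n (ψn a) (Vn a) π (θ a) := by
  unfold kernel criterion
  have h := measurable_quadForm (measurable_inv_apply hV) (hψ.const_smul (Real.sqrt n)⁻¹)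
  exact ((h.const_mul _).neg.exp).mul hπ

lemma measurable_indicator_prod {Θ : Set (E d)} (hΘ : MeasurableSet Θ) {f : α → E d → ℝ}
    (hf : Measurable fun x : α × Θ => f x.1 x.2) :
    Measurable fun x : α × E d => Θ.indicator (f x.1) x.2 := by
  have he : MeasurableEmbedding (Prod.map id Subtype.val : α × Θ → α × E d) :=
    MeasurableEmbedding.id.prodMap (MeasurableEmbedding.subtype_coe hΘ)
  have h := he.measurable_extend hf (measurable_const (a := (0 : ℝ)))
  convert h using 1
  ext ⟨a, θ⟩
  by_cases hθ : θ ∈ Θ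
  · have := he.injective.extend_apply (fun x : α × Θ => f x.1 x.2) (fun _ => (0 : ℝ)) (a, ⟨θ, hθ⟩)
    simp only [Prod.map_apply, id] at this
    rw [this, Set.indicator_of_mem hθ]
  · rw [Set.indicator_of_notMem hθ, Function.extend_apply']
    rintro ⟨⟨b, θ'⟩, h⟩
    exact hθ (by simp only [Prod.map_apply, Prod.mk.injEq] at h; rw [← h.2]; exact θ'.2)

lemma measurable_posteriorMean {Θ : Set (E d)} (hΘ : MeasurableSet Θ) (n : ℕ)
    {ψn : α → E d → E d} {Vn : α → E d → Matrix (Fin d) (Fin d) ℝ} {π : E d → ℝ}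
    (hψ : Measurable fun x : α × Θ => ψn x.1 x.2)
    (hV : ∀ i j, Measurable fun x : α × Θ => Vn x.1 x.2 i j) (hπ : ContinuousOn π Θ) :
    Measurable fun a => posteriorMean Θ n (ψn a) (Vn a) π := by
  have hπm : Measurable fun x : α × Θ => π x.2 :=
    (continuousOn_iff_continuous_domRestrict.1 hπ).measurable.comp measurable_snd
  have hk := measurable_indicator_prod hΘ (f := fun a => kernel n (ψn a) (Vn a) π)
    (measurable_kernel n (ψn := fun x : α × Θ => ψn x.1) (Vn := fun x : α × Θ => Vn x.1)
      (θ := fun x => x.2) hψ hV hπm)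
  have hI : Measurable fun a => ∫ θ in Θ, kernel n (ψn a) (Vn a) π θ := by
    simp_rw [← integral_indicator hΘ]
    exact (hk.stronglyMeasurable.integral_prod_right' (ν := volume)).measurable
  have hpost : Measurable fun x : α × E d =>
      (Θ.indicator (kernel n (ψn x.1) (Vn x.1) π) x.2 /
        ∫ θ in Θ, kernel n (ψn x.1) (Vn x.1) π θ) • x.2 :=
    (hk.div (hI.comp measurable_fst)).smul measurable_snd
  have h := (hpost.stronglyMeasurable.integral_prod_right' (ν := volume)).measurable
  convert h using 2 with a
  rw [posteriorMean, ← integral_indicator hΘ]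
  congr 1
  ext1 θ
  by_cases hθ : θ ∈ Θ <;> simp [hθ, posterior]

end Measurability

/-! ### Convergence in probability and in distribution on varying probability spaces -/

section Varying

variable {Ω : ℕ → Type*} [∀ n, MeasurableSpace (Ω n)] {P : ∀ n, Measure (Ω n)}

/-- Reduction of convergence in probability to sequences of data points: if no sequence of points
of `B`, along which one of the tightness events `T M` and eventually every one of the likely events
`A j` hold, exists, then the probability of `B` tends to zero. -/
lemma tendsto_measure_zero_of_no_sequence {B : ∀ n, Set (Ω n)} {A : ℕ → ∀ n, Set (Ω n)}
    {T : ℝ → ∀ n, Set (Ω n)} (hA : ∀ j, Tendsto (fun n => P n (A j n)ᶜ) atTop (𝓝 0))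
    (hT : ∀ a : ℝ≥0∞, 0 < a → ∃ M, ∀ᶠ n in atTop, P n (T M n)ᶜ ≤ a)
    (h : ∀ (M : ℝ) (m : ℕ → ℕ) (ω : ∀ j, Ω (m j)), Tendsto m atTop atTop →
      (∀ j, ω j ∈ B (m j)) → (∀ j, ω j ∈ T M (m j)) → (∀ j, ∀ i ≤ j, ω j ∈ A i (m j)) → False) :
    Tendsto (fun n => P n (B n)) atTop (𝓝 0) := by
  rw [ENNReal.tendsto_nhds_zero]
  by_contra! hcon
  obtain ⟨a, ha, hfreq⟩ := hcon
  obtain ⟨M, hM⟩ := hT (a / 2) (ENNReal.half_pos ha.ne')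
  have hex : ∀ j : ℕ, ∃ n, j ≤ n ∧ ∃ ω, ω ∈ B n ∧ ω ∈ T M n ∧ ∀ i ≤ j, ω ∈ A i n := by
    intro j
    have hsum : Tendsto (fun n => ∑ i ∈ Finset.range (j + 1), P n (A i n)ᶜ) atTop (𝓝 0) := by
      simpa using tendsto_finsetSum (Finset.range (j + 1)) fun i _ => hA i
    have hsmall := (ENNReal.tendsto_nhds_zero.1 hsum) (a / 2) (ENNReal.half_pos ha.ne')
    obtain ⟨n, hn, hjn, hTn, hAn⟩ :=
      (hfreq.and_eventually ((eventually_ge_atTop j).and (hM.and hsmall))).exists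
    refine ⟨n, hjn, ?_⟩
    by_contra! hno
    have hsub : B n ⊆ (T M n)ᶜ ∪ ⋃ i ∈ Finset.range (j + 1), (A i n)ᶜ := by
      intro ω hω
      by_cases hωT : ω ∈ T M n
      · obtain ⟨i, hi, hiA⟩ := hno ω hω hωT
        exact Or.inr (Set.mem_iUnion₂.2 ⟨i, Finset.mem_range.2 (by omega), hiA⟩)
      · exact Or.inl hωT
    have hle : P n (B n) ≤ a := by
      calc P n (B n) ≤ P n (T M n)ᶜ + P n (⋃ i ∈ Finset.range (j + 1), (A i n)ᶜ) :=
            (measure_mono hsub).trans (measure_union_le _ _)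
        _ ≤ a / 2 + a / 2 := by
            gcongr
            exact (measure_biUnion_finset_le _ _).trans hAn
        _ = a := ENNReal.add_halves a
    exact absurd hle (not_le.2 hn)
  choose m hm ω hB hTω hAω using hex
  exact h M m ω (tendsto_atTop_mono hm tendsto_id) hB hTω hAω

variable [∀ n, IsProbabilityMeasure (P n)]

/-- Variables converging in distribution are uniformly tight. -/
lemma exists_norm_bound_of_tendstoInDistribution {X : ∀ n, Ω n → E d} {μ : Measure (E d)}
    [IsProbabilityMeasure μ] (hX : TendstoInDistribution X atTop (id : E d → E d) P μ)
    {a : ℝ≥0∞} (ha : 0 < a) : ∃ M : ℝ, ∀ᶠ n in atTop, P n {ω | ‖X n ω‖ ≤ M}ᶜ ≤ a := by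
  have htight : Tendsto (fun M : ℝ => μ {x | M < ‖x‖}) atTop (𝓝 0) := by
    have h := tendsto_measure_norm_gt_of_isTightMeasureSet (isTightMeasureSet_singleton (μ := μ))
    simpa using h
  obtain ⟨M, hM⟩ := (htight.eventually_lt_const ha).exists
  have hclosed : IsClosed {x : E d | M + 1 ≤ ‖x‖} := isClosed_le continuous_const continuous_norm
  have hsub : {x : E d | M + 1 ≤ ‖x‖} ⊆ {x | M < ‖x‖} := fun x hx => by
    simp only [Set.mem_ofPred_eq] at hx ⊢; linarith
  have hlim := (ProbabilityMeasure.limsup_measure_closed_le_of_tendsto hX.tendsto hclosed)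
  have hlt : limsup (fun n => (P n).map (X n) {x : E d | M + 1 ≤ ‖x‖}) atTop < a := by
    refine lt_of_le_of_lt hlim ?_
    simp only [ProbabilityMeasure.coe_mk, Measure.map_id]
    exact (measure_mono hsub).trans_lt hM
  refine ⟨M + 1, ?_⟩
  filter_upwards [eventually_lt_of_limsup_lt hlt] with n hn
  rw [Measure.map_apply_of_aemeasurable (hX.forall_aemeasurable n) hclosed.measurableSet] at hn
  refine (measure_mono fun ω hω => ?_).trans hn.le
  simp only [Set.mem_compl_iff, Set.mem_ofPred_eq, not_le] at hω
  exact hω.le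

/-- Convergence in distribution depends on the laws only, so it is unaffected by transporting the
variables to other probability spaces. -/
lemma tendstoInDistribution_comp_iff {Ω' : ℕ → Type*} [∀ n, MeasurableSpace (Ω' n)]
    {Q : ∀ n, Measure (Ω' n)} [∀ n, IsProbabilityMeasure (Q n)] {μ : Measure (E d)}
    [IsProbabilityMeasure μ] {X : ∀ n, Ω n → E d} (hX : ∀ n, AEMeasurable (X n) (P n))
    {f : ∀ n, Ω' n → Ω n} (hf : ∀ n, MeasurePreserving (f n) (Q n) (P n)) :
    TendstoInDistribution (fun n => X n ∘ f n) atTop (id : E d → E d) Q μ ↔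
      TendstoInDistribution X atTop (id : E d → E d) P μ := by
  have hXf : ∀ n, AEMeasurable (X n ∘ f n) (Q n) := fun n =>
    (hX n).comp_quasiMeasurePreserving (hf n).quasiMeasurePreserving
  have hlaw : ∀ n, (Q n).map (X n ∘ f n) = (P n).map (X n) := fun n => by
    rw [← AEMeasurable.map_map_of_aemeasurable (by rw [(hf n).map_eq]; exact hX n)
      (hf n).measurable.aemeasurable, (hf n).map_eq]
  have heq : (fun n => (⟨(Q n).map (X n ∘ f n), Measure.isProbabilityMeasure_map (hXf n)⟩ :
      ProbabilityMeasure (E d))) =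
      fun n => ⟨(P n).map (X n), Measure.isProbabilityMeasure_map (hX n)⟩ := by
    funext n
    exact Subtype.ext (hlaw n)
  constructor
  · intro h
    refine ⟨hX, aemeasurable_id, ?_⟩
    rw [← heq]
    exact h.tendsto
  · intro h
    refine ⟨hXf, aemeasurable_id, ?_⟩
    rw [heq]
    exact h.tendsto

/-- Slutsky's lemma on varying probability spaces. The spaces are embedded in their product, on
which Mathlib's version for a single space applies. -/
lemma tendstoInDistribution_of_norm_sub {X Y : ∀ n, Ω n → E d} {μ : Measure (E d)}
    [IsProbabilityMeasure μ] (hX : TendstoInDistribution X atTop (id : E d → E d) P μ)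
    (hY : ∀ n, AEMeasurable (Y n) (P n))
    (h : ∀ ε : ℝ, 0 < ε → Tendsto (fun n => P n {ω | ε < ‖Y n ω - X n ω‖}) atTop (𝓝 0)) :
    TendstoInDistribution Y atTop (id : E d → E d) P μ := by
  have hpre := measurePreserving_eval_infinitePi P
  have hXm := hX.forall_aemeasurable
  rw [← tendstoInDistribution_comp_iff hY hpre]
  rw [← tendstoInDistribution_comp_iff hXm hpre] at hX
  refine tendstoInDistribution_of_tendstoInMeasure_sub _ _ hX ?_ fun n =>
    (hY n).comp_quasiMeasurePreserving (hpre n).quasiMeasurePreserving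
  rw [tendstoInMeasure_iff_norm]
  intro ε hε
  refine tendsto_of_tendsto_of_tendsto_of_le_of_le tendsto_const_nhds (h (ε / 2) (by positivity))
    (fun _ => zero_le) fun n => ?_
  have hnull : NullMeasurableSet {ω | ε / 2 < ‖Y n ω - X n ω‖} (P n) :=
    nullMeasurableSet_lt aemeasurable_const ((hY n).sub (hXm n)).norm
  calc _ ≤ Measure.infinitePi P (Function.eval n ⁻¹' {ω | ε / 2 < ‖Y n ω - X n ω‖}) := by
        refine measure_mono fun ω hω => ?_
        simp only [Set.mem_ofPred_eq, Pi.sub_apply, Function.comp, Pi.zero_apply, sub_zero] at hω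
        simp only [Set.mem_preimage, Set.mem_ofPred_eq]
        linarith
    _ = _ := (hpre n).measure_preimage hnull

end Varying

/-! ### Linear images of Gaussian laws -/

/-- The image of `N(0, S)` under `x ↦ Bx` is `N(0, BSBᵀ)`. -/
lemma map_multivariateGaussian {S : Matrix (Fin d) (Fin d) ℝ} (hS : S.PosSemidef)
    (B : Matrix (Fin d) (Fin d) ℝ) :
    (multivariateGaussian (0 : E d) S).map (fun x => WithLp.toLp 2 (B *ᵥ x.ofLp))
      = multivariateGaussian 0 (B * S * Bᵀ) := by
  have hBS : (B * S * Bᵀ).PosSemidef := by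
    simpa using hS.mul_mul_conjTranspose_same B
  have hc : Continuous fun x : E d => (WithLp.toLp 2 (B *ᵥ x.ofLp) : E d) := by
    have : Continuous fun x : E d => B *ᵥ x.ofLp := by fun_prop
    fun_prop
  have hadj : ∀ x t : E d, inner ℝ (WithLp.toLp 2 (B *ᵥ x.ofLp) : E d) t
      = inner ℝ x (WithLp.toLp 2 (Bᵀ *ᵥ t.ofLp)) := fun x t => by
    simp only [EuclideanSpace.inner_eq_star_dotProduct, star_trivial]
    rw [Matrix.dotProduct_mulVec, ← Matrix.mulVec_transpose]
  have : IsProbabilityMeasure ((multivariateGaussian (0 : E d) S).map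
      (fun x => (WithLp.toLp 2 (B *ᵥ x.ofLp) : E d))) :=
    Measure.isProbabilityMeasure_map hc.measurable.aemeasurable
  refine Measure.ext_of_charFun ?_
  funext t
  have h1 : charFun ((multivariateGaussian (0 : E d) S).map
      (fun x => (WithLp.toLp 2 (B *ᵥ x.ofLp) : E d))) t
      = charFun (multivariateGaussian (0 : E d) S) (WithLp.toLp 2 (Bᵀ *ᵥ t.ofLp)) := by
    rw [charFun_apply, charFun_apply, integral_map hc.measurable.aemeasurable (by fun_prop)]
    simp only [hadj]
  rw [h1, charFun_multivariateGaussian hS, charFun_multivariateGaussian hBS]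
  simp only [inner_zero_right]
  congr 4
  rw [← Matrix.mulVec_mulVec, ← Matrix.mulVec_mulVec, Matrix.dotProduct_mulVec t.ofLp B,
    ← Matrix.mulVec_transpose]

/-- The recentring map turns `N(0, V⋆)` into the limiting law `N(0, Ω⋆⁻¹)`. -/
lemma map_recentring_multivariateGaussian {ψ : E d → E d} {V : E d → Matrix (Fin d) (Fin d) ℝ}
    {θ : E d} (hV : (V θ).PosDef) (hJ : IsUnit (jacobian ψ θ)) :
    (multivariateGaussian (0 : E d) (V θ)).map (recentring ψ V θ)
      = multivariateGaussian 0 (OmegaStar ψ V θ)⁻¹ := by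
  have h1 : recentring ψ V θ =
      fun x => WithLp.toLp 2 ((-(jacobian ψ θ)⁻¹) *ᵥ x.ofLp) := by
    funext x
    rw [recentring_eq hV hJ, Matrix.neg_mulVec]
    rfl
  rw [h1, map_multivariateGaussian hV.posSemidef, OmegaStar, Matrix.mul_inv_rev,
    Matrix.mul_inv_rev, Matrix.nonsing_inv_nonsing_inv _
      ((Matrix.isUnit_iff_isUnit_det _).1 hV.isUnit), Matrix.transpose_neg,
    Matrix.transpose_nonsing_inv]
  simp [Matrix.mul_assoc]

/-! ### From the stochastic assumptions to typical sequences -/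

section Transfer

variable {Ω : ℕ → Type*} [∀ n, MeasurableSpace (Ω n)] {P : ∀ n, Measure (Ω n)}
  {Θ : Set (E d)} {ψn : ∀ n, Ω n → E d → E d}
  {Vn : ∀ n, Ω n → E d → Matrix (Fin d) (Fin d) ℝ} {π : E d → ℝ} {ψ : E d → E d}
  {V : E d → Matrix (Fin d) (Fin d) ℝ} {θstar : E d} {Vstar : Matrix (Fin d) (Fin d) ℝ}

lemma PriorAssumption.integrableOn (hΘ : MeasurableSet Θ)
    (h_prior : PriorAssumption P Θ Vn π θstar) : IntegrableOn π Θ := by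
  refine (lintegral_ofReal_ne_top_iff_integrable
    (h_prior.continuousOn.aestronglyMeasurable hΘ) ?_).1 ?_
  · exact (ae_restrict_iff' hΘ).2 (ae_of_all _ h_prior.nonneg)
  · rw [h_prior.normalised]
    exact ENNReal.one_ne_top

lemma PriorAssumption.integrableOn_norm_mul (hΘ : MeasurableSet Θ)
    (h_prior : PriorAssumption P Θ Vn π θstar) : IntegrableOn (fun θ => ‖θ‖ * π θ) Θ := by
  obtain ⟨p, hp, hfin, -⟩ := h_prior.moments
  have hπm := h_prior.continuousOn.aestronglyMeasurable (μ := volume) hΘ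
  have hpow : AEStronglyMeasurable (fun θ : E d => ‖θ‖ ^ p) (volume.restrict Θ) :=
    (measurable_norm.pow_const p).aestronglyMeasurable
  have hpi : IntegrableOn (fun θ => ‖θ‖ ^ p * π θ) Θ := by
    refine (lintegral_ofReal_ne_top_iff_integrable (hpow.mul hπm) ?_).1 hfin.ne
    exact (ae_restrict_iff' hΘ).2 (ae_of_all _ fun θ hθ =>
      mul_nonneg (by positivity) (h_prior.nonneg θ hθ))
  refine ((h_prior.integrableOn hΘ).add hpi).mono'
    (continuous_norm.aestronglyMeasurable.mul hπm)
    ((ae_restrict_iff' hΘ).2 (ae_of_all _ fun θ hθ => ?_))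
  have hπ := h_prior.nonneg θ hθ
  have h1 : ‖θ‖ ≤ 1 + ‖θ‖ ^ p := by
    rcases le_total ‖θ‖ 1 with h | h
    · have : 0 ≤ ‖θ‖ ^ p := by positivity
      linarith
    · have := Real.rpow_le_rpow_of_exponent_le h hp
      rw [Real.rpow_one] at this
      linarith
  rw [Real.norm_of_nonneg (by positivity)]
  calc ‖θ‖ * π θ ≤ (1 + ‖θ‖ ^ p) * π θ := by gcongr
    _ = _ := by simp only [Pi.add_apply]; ring

lemma eventually_ae_admissible (hΘ : MeasurableSet Θ)
    (hψn : ∀ n, Measurable fun x : Ω n × Θ => ψn n x.1 x.2)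
    (hVn : ∀ n i j, Measurable fun x : Ω n × Θ => Vn n x.1 x.2 i j)
    (h_weight : WeightAssumption P Θ Vn V ψ θstar Vstar)
    (h_prior : PriorAssumption P Θ Vn π θstar) :
    ∀ᶠ n in atTop, ∀ᵐ ω ∂P n, Admissible Θ π θstar n (ψn n ω) (Vn n ω) := by
  obtain ⟨δ, -, hpsd, -⟩ := h_weight.local_global
  obtain ⟨p, hp, -, hmom⟩ := h_prior.moments
  filter_upwards [hpsd, hmom] with n h1 h2
  filter_upwards [h1, h2] with ω h3 h4
  have hπm : Measurable fun θ : Θ => π θ :=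
    (continuousOn_iff_continuous_domRestrict.1 h_prior.continuousOn).measurable
  have hVω : ∀ i j, Measurable fun θ : Θ => Vn n ω θ i j := fun i j =>
    (hVn n i j).comp measurable_prodMk_left
  have hψω : Measurable fun θ : Θ => ψn n ω θ := (hψn n).comp measurable_prodMk_left
  refine ⟨h3.1, ?_, ?_⟩
  · have hm : AEMeasurable (fun θ => ENNReal.ofReal (Vn n ω θ).det ^ (-(1 / 2) : ℝ) *
        ENNReal.ofReal (‖θ - θstar‖ ^ p * π θ)) (volume.restrict Θ) := by
      refine aemeasurable_restrict_of_measurable_subtype hΘ ?_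
      have hdet := measurable_det hVω
      have hnorm : Measurable fun θ : Θ => ‖(θ : E d) - θstar‖ := by fun_prop
      exact (hdet.ennreal_ofReal.pow_const _).mul ((hnorm.pow_const p).mul hπm).ennreal_ofReal
    filter_upwards [ae_lt_top' hm h4.ne, ae_restrict_mem hΘ] with θ hfin hθ
    by_cases hdet : (Vn n ω θ).det = 0
    · -- at a singular matrix the integrand is `∞ * (‖θ - θ⋆‖ ^ p * π θ)`
      rw [hdet, ENNReal.ofReal_zero, ENNReal.zero_rpow_of_neg (by norm_num)] at hfin
      have h5 : ENNReal.ofReal (‖θ - θstar‖ ^ p * π θ) = 0 := by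
        by_contra h
        rw [ENNReal.top_mul h] at hfin
        exact lt_irrefl _ hfin
      have hπ := h_prior.nonneg θ hθ
      have h6 : ‖θ - θstar‖ ^ p * π θ = 0 :=
        le_antisymm (ENNReal.ofReal_eq_zero.1 h5) (by positivity)
      rcases mul_eq_zero.1 h6 with h7 | h7
      · right; left
        exact sub_eq_zero.1 (norm_eq_zero.1 ((Real.rpow_eq_zero (norm_nonneg _)
          (by linarith)).1 h7))
      · exact Or.inl h7
    · right; right
      exact (h3.1 θ hθ).posDef_iff_isUnit.2
        ((Matrix.isUnit_iff_isUnit_det _).2 (isUnit_iff_ne_zero.2 hdet))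
  · exact (aemeasurable_restrict_of_measurable_subtype hΘ
      (measurable_kernel n (ψn := fun _ : Θ => ψn n ω) (Vn := fun _ : Θ => Vn n ω)
        (θ := fun θ => θ) hψω hVω hπm)).aestronglyMeasurable

variable [∀ n, IsProbabilityMeasure (P n)]

lemma EstimatingAssumption.star_mem (h_est : EstimatingAssumption P Θ ψn ψ θstar Vstar) :
    θstar ∈ Θ :=
  interior_subset h_est.interior

lemma WeightAssumption.posDef_star (h_est : EstimatingAssumption P Θ ψn ψ θstar Vstar)
    (h_weight : WeightAssumption P Θ Vn V ψ θstar Vstar) : (V θstar).PosDef := by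
  obtain ⟨δ, hδ, -, -, -, h⟩ := h_weight.local_global
  exact h θstar h_est.star_mem (by simpa using hδ.le)

lemma limitModel_of_assumptions (hΘ : MeasurableSet Θ)
    (h_est : EstimatingAssumption P Θ ψn ψ θstar Vstar)
    (h_weight : WeightAssumption P Θ Vn V ψ θstar Vstar)
    (h_prior : PriorAssumption P Θ Vn π θstar) : LimitModel Θ ψ V π θstar := by
  have hnhds : Θ ∈ 𝓝 θstar := mem_interior_iff_mem_nhds.1 h_est.interior
  obtain ⟨δ, hδ, -, hpsd, hcont, -⟩ := h_weight.local_global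
  obtain ⟨δ', hδ', -, hdiff⟩ := h_est.contDiff
  exact
    { measurableSet := hΘ
      mem_nhds := hnhds
      differentiableAt := (hdiff.contDiffAt (Metric.closedBall_mem_nhds θstar hδ')).differentiableAt
        one_ne_zero
      invertible := h_est.invertible
      posSemidef := hpsd
      posDef_star := h_weight.posDef_star h_est
      continuousAt := hcont.continuousAt
        (Filter.inter_mem hnhds (Metric.closedBall_mem_nhds θstar hδ))
      separated := h_weight.separated
      prior_nonneg := h_prior.nonneg
      prior_pos := h_prior.pos_star
      prior_continuousAt := h_prior.continuousOn.continuousAt hnhds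
      prior_integrable := h_prior.integrableOn hΘ
      prior_moment := h_prior.integrableOn_norm_mul hΘ }

/-- Events whose probability does not vanish contain the members of a typical sequence: if `B`
contains no typical sequence, then its probability tends to zero. -/
lemma tendsto_measure_zero_of_typicalSeq (hΘ : MeasurableSet Θ)
    (hψn : ∀ n, Measurable fun x : Ω n × Θ => ψn n x.1 x.2)
    (hVn : ∀ n i j, Measurable fun x : Ω n × Θ => Vn n x.1 x.2 i j)
    (h_est : EstimatingAssumption P Θ ψn ψ θstar Vstar)
    (h_weight : WeightAssumption P Θ Vn V ψ θstar Vstar)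
    (h_prior : PriorAssumption P Θ Vn π θstar) {B : ∀ n, Set (Ω n)}
    (hB : ∀ (m : ℕ → ℕ) (ω : ∀ j, Ω (m j)),
      TypicalSeq Θ ψ V π θstar m (fun j => ψn (m j) (ω j)) (fun j => Vn (m j) (ω j)) →
      (∀ j, ω j ∈ B (m j)) → False) :
    Tendsto (fun n => P n (B n)) atTop (𝓝 0) := by
  have hstar := h_est.star_mem
  obtain ⟨δ₀, hδ₀, hpd, -⟩ := h_weight.local_global
  set e : ℕ → ℝ := fun j => 1 / ((j : ℝ) + 1) with he
  have he0 : ∀ j, 0 < e j := fun j => by simp only [he]; positivity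
  choose δ hδ hequi using fun j => h_est.equicontinuous (e j) (he0 j)
  set A : ℕ → ∀ n, Set (Ω n) := fun j n => {ω |
    (Admissible Θ π θstar n (ψn n ω) (Vn n ω) ∧
      ∀ θ ∈ Θ, ‖θ - θstar‖ ≤ δ₀ → (Vn n ω θ).PosDef) ∧
    (∀ θ ∈ Θ, ‖(n : ℝ)⁻¹ • ψn n ω θ - ψ θ‖ ≤ e j) ∧
    (∀ θ ∈ Θ, ‖Vn n ω θ - V θ‖ ≤ e j) ∧
    ∀ θ ∈ Θ, ∀ θ' ∈ Θ, ‖θ - θ'‖ < δ j →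
      Real.sqrt n * ‖(n : ℝ)⁻¹ • (ψn n ω θ - ψn n ω θ') - (ψ θ - ψ θ')‖ /
        (1 + Real.sqrt n * ‖θ - θ'‖) ≤ e j} with hAdef
  have hA : ∀ j, Tendsto (fun n => P n (A j n)ᶜ) atTop (𝓝 0) := by
    intro j
    have hsum := ((h_est.uniform (e j) (he0 j)).add (h_weight.uniform (e j) (he0 j))).add
      (hequi j)
    simp only [add_zero] at hsum
    refine tendsto_of_tendsto_of_tendsto_of_le_of_le' tendsto_const_nhds hsum
      (Eventually.of_forall fun _ => zero_le) ?_
    filter_upwards [eventually_ae_admissible hΘ hψn hVn h_weight h_prior, hpd] with n h1 h2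
    have hae : ∀ᵐ ω ∂P n, Admissible Θ π θstar n (ψn n ω) (Vn n ω) ∧
        ∀ θ ∈ Θ, ‖θ - θstar‖ ≤ δ₀ → (Vn n ω θ).PosDef := by
      filter_upwards [h1, h2] with ω h3 h4 using ⟨h3, h4.2⟩
    set U : Set (Ω n) := ({ω | ∃ θ ∈ Θ, e j < ‖(n : ℝ)⁻¹ • ψn n ω θ - ψ θ‖} ∪
        {ω | ∃ θ ∈ Θ, e j < ‖Vn n ω θ - V θ‖}) ∪
        {ω | ∃ θ ∈ Θ, ∃ θ' ∈ Θ, ‖θ - θ'‖ < δ j ∧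
          e j < Real.sqrt n * ‖(n : ℝ)⁻¹ • (ψn n ω θ - ψn n ω θ') - (ψ θ - ψ θ')‖ /
            (1 + Real.sqrt n * ‖θ - θ'‖)} with hU
    have hsub : (A j n)ᶜ ≤ᵐ[P n] U := by
      filter_upwards [hae] with ω hω hωA
      by_contra hno
      have hno' : ω ∉ U := hno
      simp only [hU, Set.mem_union, Set.mem_ofPred_eq, not_or, not_exists, not_and,
        not_lt] at hno'
      exact hωA ⟨hω, hno'.1.1, hno'.1.2, hno'.2⟩
    refine (measure_mono_ae hsub).trans ((measure_union_le _ _).trans ?_)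
    gcongr
    exact measure_union_le _ _
  refine tendsto_measure_zero_of_no_sequence
    (T := fun M n => {ω | ‖(Real.sqrt n)⁻¹ • ψn n ω θstar‖ ≤ M}) hA
    (fun a ha => exists_norm_bound_of_tendstoInDistribution h_est.clt ha) ?_
  intro M m ω hm hωB hωT hωA
  have hsmall : ∀ ε : ℝ, 0 < ε → ∃ i, e i ≤ ε := fun ε hε => by
    obtain ⟨i, hi⟩ := exists_nat_one_div_lt hε
    exact ⟨i, hi.le⟩
  refine hB m ω
    { tendsto_size := hm
      admissible := fun k => (hωA k 0 (Nat.zero_le k)).1.1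
      posDef_near := ⟨δ₀, hδ₀, fun k => (hωA k 0 (Nat.zero_le k)).1.2⟩
      uniform := fun ε hε => ?_
      weight_uniform := fun ε hε => ?_
      equicontinuous := fun ε hε => ?_
      bounded := ⟨M, hωT⟩ } hωB
  · obtain ⟨i, hi⟩ := hsmall ε hε
    filter_upwards [eventually_ge_atTop i] with k hk θ hθ
    exact ((hωA k i hk).2.1 θ hθ).trans hi
  · obtain ⟨i, hi⟩ := hsmall ε hε
    filter_upwards [eventually_ge_atTop i] with k hk θ hθ
    exact ((hωA k i hk).2.2.1 θ hθ).trans hi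
  · obtain ⟨i, hi⟩ := hsmall ε hε
    refine ⟨δ i, hδ i, ?_⟩
    filter_upwards [eventually_ge_atTop i] with k hk θ hθ hlt
    have h := ((hωA k i hk).2.2.2 θ hθ θstar hstar hlt).trans hi
    rwa [div_le_iff₀ (by positivity)] at h

end Transfer

end QPosterior

end

theorem theorem2 {d : ℕ} {Ω : ℕ → Type*} [∀ n, MeasurableSpace (Ω n)]
    (P : ∀ n, Measure (Ω n)) [∀ n, IsProbabilityMeasure (P n)]
    (Θ : Set (QPosterior.E d)) (hΘ : MeasurableSet Θ)
    -- the cumulative loss, its gradient and the variance estimator, as functions of the data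
    (q : ∀ n, Ω n → QPosterior.E d → ℝ)
    (ψn : ∀ n, Ω n → QPosterior.E d → QPosterior.E d)
    (Vn : ∀ n, Ω n → QPosterior.E d → Matrix (Fin d) (Fin d) ℝ)
    (hgrad : ∀ n, ∀ θ ∈ Θ, ∀ᵐ ω ∂P n, HasGradientWithinAt (q n ω) (ψn n ω θ) Θ θ)
    (hψn : ∀ n, Measurable fun x : Ω n × Θ => ψn n x.1 x.2)
    (hVn : ∀ n i j, Measurable fun x : Ω n × Θ => Vn n x.1 x.2 i j)
    -- the prior density and the non-random limits
    (π : QPosterior.E d → ℝ)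
    (ψ : QPosterior.E d → QPosterior.E d)
    (V : QPosterior.E d → Matrix (Fin d) (Fin d) ℝ)
    (θstar : QPosterior.E d) (Vstar : Matrix (Fin d) (Fin d) ℝ)
    (h_est : QPosterior.EstimatingAssumption P Θ ψn ψ θstar Vstar)
    (h_weight : QPosterior.WeightAssumption P Θ Vn V ψ θstar Vstar)
    (h_prior : QPosterior.PriorAssumption P Θ Vn π θstar) :
    -- the posterior and its mean exist
    (∀ᶠ n in atTop, ∀ᵐ ω ∂P n,
      IntegrableOn (QPosterior.kernel n (ψn n ω) (Vn n ω) π) Θ ∧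
      0 < ∫ θ in Θ, QPosterior.kernel n (ψn n ω) (Vn n ω) π θ ∧
      IntegrableOn (fun θ => QPosterior.posterior Θ n (ψn n ω) (Vn n ω) π θ • θ) Θ) ∧
    -- asymptotic normality of the posterior in weighted `L¹`, in probability
    (∀ ε : ℝ, 0 < ε → Tendsto (fun n => P n {ω | ENNReal.ofReal ε <
      ∫⁻ ϑ in QPosterior.localSpace Θ n θstar
          (QPosterior.recentring ψ V θstar (ψn n ω θstar)),
        ENNReal.ofReal (‖ϑ‖ *
          |QPosterior.localPosterior Θ n (ψn n ω) (Vn n ω) π θstar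
              (QPosterior.recentring ψ V θstar (ψn n ω θstar)) ϑ -
            QPosterior.gaussianDensity (QPosterior.OmegaStar ψ V θstar)⁻¹ ϑ|)})
      atTop (𝓝 0)) ∧
    -- asymptotic normality of the posterior mean
    TendstoInDistribution
      (fun (n : ℕ) ω => Real.sqrt n •
        (QPosterior.posteriorMean Θ n (ψn n ω) (Vn n ω) π - θstar))
      atTop (id : QPosterior.E d → QPosterior.E d) P
      (multivariateGaussian 0 (QPosterior.OmegaStar ψ V θstar)⁻¹) := by
  have hL := QPosterior.limitModel_of_assumptions hΘ h_est h_weight h_prior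
  refine ⟨?_, ?_, ?_⟩
  · filter_upwards [QPosterior.eventually_ae_admissible hΘ hψn hVn h_weight h_prior] with n hn
    filter_upwards [hn] with ω hω
    exact ⟨hL.integrableOn_kernel hω, hL.integral_kernel_pos hω,
      hL.integrableOn_posterior_smul hω⟩
  · intro ε hε
    refine QPosterior.tendsto_measure_zero_of_typicalSeq hΘ hψn hVn h_est h_weight h_prior ?_
    intro m ω hS hω
    obtain ⟨k, hk⟩ := ((hS.tendsto_lintegral_localPosterior hL).eventually_lt_const
      (ENNReal.ofReal_pos.2 hε)).exists
    exact lt_asymm hk (hω k)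
  · -- the limit law of the recentring term, by the continuous mapping theorem
    have hX : TendstoInDistribution
        (fun (n : ℕ) ω => (Real.sqrt n)⁻¹ • QPosterior.recentring ψ V θstar (ψn n ω θstar))
        atTop (id : QPosterior.E d → QPosterior.E d) P
        (multivariateGaussian 0 (QPosterior.OmegaStar ψ V θstar)⁻¹) := by
      have hc : Continuous (QPosterior.recentring ψ V θstar) := by
        unfold QPosterior.recentring
        fun_prop
      have h := h_est.clt.continuous_comp hc
      have hlaw := QPosterior.map_recentring_multivariateGaussian hL.posDef_star hL.invertible
      rw [h_weight.at_star] at hlaw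
      have heq : (fun (n : ℕ) => QPosterior.recentring ψ V θstar ∘
            fun ω => (Real.sqrt n)⁻¹ • ψn n ω θstar)
          = fun (n : ℕ) ω => (Real.sqrt n)⁻¹ • QPosterior.recentring ψ V θstar (ψn n ω θstar) := by
        funext n ω
        exact QPosterior.recentring_smul _ _ _ _ _
      rw [heq] at h
      refine ⟨h.forall_aemeasurable, aemeasurable_id, ?_⟩
      convert h.tendsto using 2
      refine congrArg 𝓝 (Subtype.ext ?_)
      simp only [Measure.map_id, Function.comp_id]
      exact hlaw.symm
    refine QPosterior.tendstoInDistribution_of_norm_sub hX (fun n => ?_) fun ε hε => ?_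
    · exact (((QPosterior.measurable_posteriorMean hΘ n (hψn n) (hVn n)
        h_prior.continuousOn).sub_const θstar).const_smul (Real.sqrt n)).aemeasurable
    · refine QPosterior.tendsto_measure_zero_of_typicalSeq hΘ hψn hVn h_est h_weight h_prior ?_
      intro m ω hS hω
      obtain ⟨k, hk⟩ := ((hS.tendsto_posteriorMean hL).eventually_lt_const hε).exists
      exact lt_asymm hk (hω k)
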